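/- Let $p$ be a prime and $n\ge 1$ an integer. **Valuated trees.** A tree is a set $T$ with a distinguished element $*$ and a map $p\colon T\to T$ such that $p(*)=*$ and every $x\in T$ satisfies $p^k(x)=*$ for some $k\ge 0$. A valuation on $T$ is a map $v\colon T\to\mathbb{Z}_{\ge 0}\cup\{\infty\}$ with $v(p(x))>v(x)$ for all $x$, where by convention $\infty>\infty$. Let $\operatorname{ValTree}_n$ be the category of finite valuated trees $T$ with $v(x)\le n-1$ for all $x\ne *$; its morphisms are the maps $f$ with $f(p(x))=p(f(x))$ and $v(f(x))\ge v(x)$ for all $x$. A tree $T\in\operatorname{ValTree}_n$ is *irretractable* if the only morphisms $r\colon T\to T$ with $r^2=r$ are the identity and the map sending everything to $*$. It is *nontrivial* if $T\neq\{*\}$. **The representation $M_T$.** For $T\in\operatorname{ValTree}_n$ let $S(T)$ be the free abelian group on $T$ modulo the relations $p[x]=[p(x)]$ for $x\in T$, and $[*]=0$; it is a finitely generated $\mathbb{Z}/(p^n)$-module. A morphism $f$ of trees induces $S(f)\colon [x]\mapsto [f(x)]$. Define $T=T_{0}\subseteq T_{1}\subseteq\dots\subseteq T_{n-1}$ in $\operatorname{ValTree}_n$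 recursively by $$T_i=T_{i-1}\cup\{(x,m)\in T\times\mathbb{Z}_{\ge 0}\mid v(x)=i,\ h(x)<i,\ 0\le m<i\},$$ where $h(x)=\max\{t\ge 0\mid p^t(y)=x\text{ for some }y\in T_{i-1}\}$, and where the new elements satisfy $v(x,m)=m$, $p(x,m)=(x,m+1)$ if $m+1<i$, and $p(x,i-1)=x$. Let $\gamma\colon T\to T_{n-1}$ be the inclusion. Let $\operatorname{sub}(\mathbb{Z}/(p^n))$ be the category of monomorphisms $M_1\to M_2$ of finitely generated $\mathbb{Z}/(p^n)$-modules, with commutative squares as morphisms. Let $M_T$ be the object $S(\gamma)\colon S(T)\to S(T_{n-1})$ of $\operatorname{sub}(\mathbb{Z}/(p^n))$. An object is *indecomposable* if it is nonzero and not isomorphic to a direct sum of two nonzero objects. **Statement.** Let $T\in\operatorname{ValTree}_n$. Then: 1. $M_T$ is indecomposable if and only if $T$ is nontrivial and irretractable. 2. If $T$ is irretractable and $T'\in\operatorname{ValTree}_n$ satisfies $M_T\cong M_{T'}$, then $T\cong T'$. 3. There are an integer $m\ge 0$ and nontrivial irretractable $T_1',\dots,T_m'\in\operatorname{ValTree}_n$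 such that $$M_T\cong M_{T_1'}\oplus\dots\oplus M_{T_m'},$$ and the $T_i'$ are unique up to isomorphism and permutation: if nontrivial irretractable $T_1'',\dots,T_{m'}''\in\operatorname{ValTree}_n$ also satisfy $M_T\cong M_{T_1''}\oplus\dots\oplus M_{T_{m'}''}$, then there is a bijection $e\colon\{1,\dots,m'\}\to\{1,\dots,m\}$ with $T_j''\cong T_{e(j)}'$ for all $j$. -/

import Mathlib

open CategoryTheory CategoryTheory.Limits

universe u w

noncomputable section

/-! ### Valuated trees -/

/-- A finite valuated tree all of whose elements other than the distinguished one have value at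
most `n - 1` (that is, value `< n`): a finite set with a distinguished element `root`, a function
`par` (written `p` on paper) that fixes `root` and some iterate of which sends any given element
to `root`, and a valuation `v` with `v (par x) > v x`, where `∞ > ∞` is allowed by convention. -/
structure ValTree (n : ℕ) where
  carrier : Type u
  [finite : Finite carrier]
  root : carrier
  par : carrier → carrier
  par_root : par root = root
  exists_iterate : ∀ x, ∃ k : ℕ, par^[k] x = root
  v : carrier → ℕ∞
  v_lt_v_par : ∀ x, v x < v (par x) ∨ (v x = ⊤ ∧ v (par x) = ⊤)
  v_lt : ∀ x, x ≠ root → v x < n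

namespace ValTree

attribute [instance] ValTree.finite

variable {n : ℕ}

/-- Morphisms of valuated trees. -/
@[ext]
structure Hom (T T' : ValTree.{u} n) where
  toFun : T.carrier → T'.carrier
  map_par : ∀ x, toFun (T.par x) = T'.par (toFun x)
  le_v : ∀ x, T.v x ≤ T'.v (toFun x)

/-- The category of finite valuated trees with values at most `n - 1`. -/
instance : Category (ValTree.{u} n) where
  Hom := Hom
  id T := ⟨id, fun _ => rfl, fun _ => le_rfl⟩
  comp f g := ⟨g.toFun ∘ f.toFun, fun x => by simp [f.map_par, g.map_par],
    fun x => (f.le_v x).trans (g.le_v _)⟩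

/-- The only morphisms `r : T ⟶ T` with `r² = r` are the identity and the morphism sending
everything to the distinguished element. The one-element tree is irretractable in this sense. -/
def Irretractable (T : ValTree.{u} n) : Prop :=
  ∀ r : T ⟶ T, r ≫ r = r → r = 𝟙 T ∨ ∀ x, r.toFun x = T.root

theorem v_root (T : ValTree.{u} n) : T.v T.root = ⊤ := by
  have h := T.v_lt_v_par T.root
  rw [T.par_root] at h
  rcases h with h | h
  · exact absurd h (lt_irrefl _)
  · exact h.1

theorem iterate_root (T : ValTree.{u} n) (k : ℕ) : T.par^[k] T.root = T.root :=
  Function.iterate_fixed T.par_root k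

theorem le_v_iterate (T : ValTree.{u} n) (x : T.carrier) (k : ℕ) :
    (k : ℕ∞) ≤ T.v (T.par^[k] x) := by
  induction k with
  | zero => simp
  | succ k ih =>
    rw [Function.iterate_succ_apply']
    rcases T.v_lt_v_par (T.par^[k] x) with h | h
    · exact_mod_cast Order.add_one_le_of_lt (ih.trans_lt h)
    · simp [h.2]

theorem iterate_eq_root (T : ValTree.{u} n) (x : T.carrier) : T.par^[n] x = T.root := by
  by_contra h
  exact absurd (T.v_lt _ h) (not_lt.mpr (T.le_v_iterate x n))

/-! ### The simply presented group of a valuated tree -/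

/-- The subgroup of the free abelian group on `T` generated by the relations
`p [x] - [par x]` and `[root]`. -/
def relations (p : ℕ) (T : ValTree.{u} n) : AddSubgroup (T.carrier →₀ ℤ) :=
  AddSubgroup.closure
    (Set.range (fun x => (p : ℤ) • Finsupp.single x 1 - Finsupp.single (T.par x) 1) ∪
      {Finsupp.single T.root 1})

/-- The group `S(T)`: the free abelian group on `T` modulo the relations. -/
def S (p : ℕ) (T : ValTree.{u} n) : Type u := (T.carrier →₀ ℤ) ⧸ T.relations p

instance (p : ℕ) (T : ValTree.{u} n) : AddCommGroup (T.S p) :=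
  inferInstanceAs (AddCommGroup ((T.carrier →₀ ℤ) ⧸ T.relations p))

/-- The quotient map onto `S(T)`. -/
def mkS (p : ℕ) (T : ValTree.{u} n) : (T.carrier →₀ ℤ) →+ T.S p :=
  QuotientAddGroup.mk' (T.relations p)

/-- The class `[x]` in `S(T)`. -/
def cls (p : ℕ) (T : ValTree.{u} n) (x : T.carrier) : T.S p := T.mkS p (Finsupp.single x 1)

theorem mkS_surjective (p : ℕ) (T : ValTree.{u} n) : Function.Surjective (T.mkS p) :=
  QuotientAddGroup.mk'_surjective _

theorem mkS_eq_zero_iff (p : ℕ) (T : ValTree.{u} n) (b : T.carrier →₀ ℤ) :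
    T.mkS p b = 0 ↔ b ∈ T.relations p :=
  QuotientAddGroup.eq_zero_iff b

theorem cls_root (p : ℕ) (T : ValTree.{u} n) : T.cls p T.root = 0 :=
  (T.mkS_eq_zero_iff p _).2 (AddSubgroup.subset_closure (Or.inr rfl))

theorem nsmul_cls (p : ℕ) (T : ValTree.{u} n) (x : T.carrier) :
    p • T.cls p x = T.cls p (T.par x) := by
  have h : T.mkS p ((p : ℤ) • Finsupp.single x 1 - Finsupp.single (T.par x) 1) = 0 :=
    (T.mkS_eq_zero_iff p _).2 (AddSubgroup.subset_closure (Or.inl ⟨x, rfl⟩))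
  rw [map_sub, map_zsmul, sub_eq_zero, natCast_zsmul] at h
  exact h

theorem pow_nsmul_cls (p : ℕ) (T : ValTree.{u} n) (x : T.carrier) (k : ℕ) :
    p ^ k • T.cls p x = T.cls p (T.par^[k] x) := by
  induction k generalizing x with
  | zero => simp
  | succ k ih => rw [pow_succ, mul_smul, nsmul_cls, ih, Function.iterate_succ_apply]

theorem S_induction {p : ℕ} {T : ValTree.{u} n} {P : T.S p → Prop} (b : T.S p)
    (h0 : P 0) (hadd : ∀ a b, P a → P b → P (a + b))
    (hcls : ∀ (k : ℤ) x, P (k • T.cls p x)) : P b := by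
  obtain ⟨b, rfl⟩ := T.mkS_surjective p b
  induction b using Finsupp.induction_linear with
  | zero => simpa using h0
  | add f g hf hg => rw [map_add]; exact hadd _ _ hf hg
  | single x k =>
    have : Finsupp.single x k = k • Finsupp.single x (1 : ℤ) := by simp
    rw [this, map_zsmul]
    exact hcls k x

theorem pow_nsmul_S (p : ℕ) (T : ValTree.{u} n) (b : T.S p) : p ^ n • b = 0 := by
  induction b using S_induction with
  | h0 => simp
  | hadd a b ha hb => rw [smul_add, ha, hb, add_zero]
  | hcls k x => rw [smul_comm, pow_nsmul_cls, iterate_eq_root, cls_root, smul_zero]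

/-- `S(T)` is killed by `p ^ n`, hence a module over `ℤ/(p ^ n)` in the only possible way. -/
instance (p : ℕ) (T : ValTree.{u} n) : Module (ZMod (p ^ n)) (T.S p) :=
  AddCommGroup.zmodModule (T.pow_nsmul_S p)

instance (p : ℕ) (T : ValTree.{u} n) : Module.Finite (ZMod (p ^ n)) (T.S p) := by
  have : Module.Finite ℤ (T.S p) :=
    Module.Finite.of_surjective (T.mkS p).toIntLinearMap (T.mkS_surjective p)
  exact Module.Finite.of_restrictScalars_finite ℤ (ZMod (p ^ n)) (T.S p)

/-- The homomorphism `S(f) : S(T) → S(T')`, `[x] ↦ [f x]`, as a map of abelian groups. -/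
def mapSAdd (p : ℕ) {T T' : ValTree.{u} n} (f : T ⟶ T') : T.S p →+ T'.S p :=
  QuotientAddGroup.lift (T.relations p)
    ((T'.mkS p).comp (Finsupp.mapDomain.addMonoidHom f.toFun)) (by
      have hroot : f.toFun T.root = T'.root := by
        obtain ⟨k, hk⟩ := T'.exists_iterate (f.toFun T.root)
        have h : T'.par (f.toFun T.root) = f.toFun T.root := by
          rw [← f.map_par, T.par_root]
        rw [← hk, Function.iterate_fixed h k]
      rw [relations, AddSubgroup.closure_le]
      rintro _ (⟨x, rfl⟩ | rfl)
      · have h := T'.nsmul_cls p (f.toFun x)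
        rw [← f.map_par, ← natCast_zsmul] at h
        change T'.mkS p (Finsupp.mapDomain.addMonoidHom f.toFun _) = 0
        simp only [map_sub, map_zsmul, Finsupp.mapDomain.addMonoidHom_apply,
          Finsupp.mapDomain_single]
        exact sub_eq_zero.2 h
      · change T'.mkS p (Finsupp.mapDomain.addMonoidHom f.toFun _) = 0
        simp only [Finsupp.mapDomain.addMonoidHom_apply, Finsupp.mapDomain_single, hroot]
        exact T'.cls_root p)

/-- The homomorphism `S(f) : S(T) → S(T')` of `ℤ/(p ^ n)`-modules. -/
def mapS (p : ℕ) {T T' : ValTree.{u} n} (f : T ⟶ T') : T.S p →ₗ[ZMod (p ^ n)] T'.S p :=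
  (mapSAdd p f).toZModLinearMap (p ^ n)

/-! ### The filtration `T = T₀ ⊆ T₁ ⊆ ⋯` -/

/-- The sets `Tᵢ` are realized as subsets of the disjoint union of `T` and `T × ℕ`. -/
abbrev Ext (T : ValTree.{u} n) : Type u := T.carrier ⊕ T.carrier × ℕ

/-- The function `p` on the ambient set: it is the given one on `T`, and `(x, m)` is sent to
`(x, m + 1)` if `m + 1 < v x` and to `x` otherwise. -/
def extPar (T : ValTree.{u} n) : T.Ext → T.Ext
  | .inl x => .inl (T.par x)
  | .inr (x, m) => if ((m + 1 : ℕ) : ℕ∞) < T.v x then .inr (x, m + 1) else .inl x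

/-- The value on the ambient set: `(x, m)` has value `m`. -/
def extV (T : ValTree.{u} n) : T.Ext → ℕ∞
  | .inl x => T.v x
  | .inr (_, m) => m

/-- The height of `z` in a subset `A` of the ambient set: the supremum of all `t` such that
`p ^ t (y) = z` for some `y ∈ A`. -/
def heightIn (T : ValTree.{u} n) (A : Set T.Ext) (z : T.Ext) : ℕ∞ :=
  ⨆ (t : ℕ) (_ : ∃ y ∈ A, T.extPar^[t] y = z), (t : ℕ∞)

/-- The underlying set of `Tᵢ`: `T₀ = T`, and `Tᵢ` is obtained from `Tᵢ₋₁` by adding all pairs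
`(x, m)` with `x ∈ T` of value `i` and of height `< i` in `Tᵢ₋₁`, and `0 ≤ m < i`. -/
def stageSet (T : ValTree.{u} n) : ℕ → Set T.Ext
  | 0 => Set.range Sum.inl
  | i + 1 => T.stageSet i ∪
      {z | ∃ (x : T.carrier) (m : ℕ), z = .inr (x, m) ∧ T.v x = (i + 1 : ℕ) ∧
        T.heightIn (T.stageSet i) (.inl x) < (i + 1 : ℕ) ∧ m < i + 1}

theorem inl_mem_stageSet (T : ValTree.{u} n) (i : ℕ) (x : T.carrier) :
    .inl x ∈ T.stageSet i := by
  induction i with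
  | zero => exact ⟨x, rfl⟩
  | succ i ih => exact Or.inl ih

theorem lt_v_of_inr_mem (T : ValTree.{u} n) {i : ℕ} {x : T.carrier} {m : ℕ}
    (h : .inr (x, m) ∈ T.stageSet i) : (m : ℕ∞) < T.v x ∧ T.v x ≤ i := by
  induction i with
  | zero => obtain ⟨y, hy⟩ := h; cases hy
  | succ i ih =>
    rcases h with h | ⟨y, k, hz, hv, -, hk⟩
    · exact ⟨(ih h).1, (ih h).2.trans (by exact_mod_cast Nat.le_succ i)⟩
    · cases hz
      rw [hv]
      exact ⟨by exact_mod_cast hk, le_rfl⟩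

theorem inr_succ_mem (T : ValTree.{u} n) {i : ℕ} {x : T.carrier} {m k : ℕ}
    (h : .inr (x, m) ∈ T.stageSet i) (hk : (k : ℕ∞) < T.v x) :
    .inr (x, k) ∈ T.stageSet i := by
  induction i with
  | zero => obtain ⟨y, hy⟩ := h; cases hy
  | succ i ih =>
    rcases h with h | ⟨y, l, hz, hv, hh, hl⟩
    · exact Or.inl (ih h)
    · cases hz
      rw [hv] at hk
      exact Or.inr ⟨x, k, rfl, hv, hh, by exact_mod_cast hk⟩

theorem extPar_mem (T : ValTree.{u} n) (i : ℕ) {z : T.Ext} (h : z ∈ T.stageSet i) :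
    T.extPar z ∈ T.stageSet i := by
  rcases z with x | ⟨x, m⟩
  · exact T.inl_mem_stageSet i _
  · simp only [extPar]
    split_ifs with hm
    · exact T.inr_succ_mem h hm
    · exact T.inl_mem_stageSet i x

theorem extV_lt (T : ValTree.{u} n) (i : ℕ) {z : T.Ext} (h : z ∈ T.stageSet i) :
    T.extV z < T.extV (T.extPar z) ∨ (T.extV z = ⊤ ∧ T.extV (T.extPar z) = ⊤) := by
  rcases z with x | ⟨x, m⟩
  · exact T.v_lt_v_par x
  · left
    simp only [extPar]
    split_ifs with hm
    · simp only [extV]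
      exact_mod_cast Nat.lt_succ_self m
    · exact (T.lt_v_of_inr_mem h).1

theorem extV_lt_n (T : ValTree.{u} n) (i : ℕ) {z : T.Ext} (h : z ∈ T.stageSet i)
    (hz : z ≠ .inl T.root) : T.extV z < n := by
  rcases z with x | ⟨x, m⟩
  · exact T.v_lt x (fun e => hz (by rw [e]))
  · have h := T.lt_v_of_inr_mem h
    refine h.1.trans (T.v_lt x ?_)
    rintro rfl
    rw [T.v_root] at h
    exact absurd h.2 (by simp)

theorem finite_stageSet (T : ValTree.{u} n) (i : ℕ) : (T.stageSet i).Finite := by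
  refine ((Set.finite_range (Sum.inl : T.carrier → T.Ext)).union
    (Set.finite_range (fun q : T.carrier × Fin i => (.inr (q.1, (q.2 : ℕ)) : T.Ext)))).subset ?_
  rintro (x | ⟨x, m⟩) h
  · exact Or.inl ⟨x, rfl⟩
  · have h := T.lt_v_of_inr_mem h
    have hm : m < i := by exact_mod_cast h.1.trans_le h.2
    exact Or.inr ⟨(x, ⟨m, hm⟩), rfl⟩

/-- The valuated tree `Tᵢ`. -/
def stage (T : ValTree.{u} n) (i : ℕ) : ValTree.{u} n :=
  have key : ∀ (z : T.stageSet i) (k : ℕ),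
      (k : ℕ∞) ≤ T.extV (((fun z : T.stageSet i =>
        (⟨T.extPar z.1, T.extPar_mem i z.2⟩ : T.stageSet i))^[k] z).1) := by
    intro z k
    induction k with
    | zero => simp
    | succ k ih =>
      rw [Function.iterate_succ_apply']
      rcases T.extV_lt i (Subtype.prop ((fun z : T.stageSet i =>
        (⟨T.extPar z.1, T.extPar_mem i z.2⟩ : T.stageSet i))^[k] z)) with h | h
      · exact_mod_cast Order.add_one_le_of_lt (ih.trans_lt h)
      · simp [h.2]
  { carrier := T.stageSet i
    finite := (T.finite_stageSet i).to_subtype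
    root := ⟨.inl T.root, T.inl_mem_stageSet i _⟩
    par := fun z => ⟨T.extPar z.1, T.extPar_mem i z.2⟩
    par_root := by simp [extPar, T.par_root]
    exists_iterate := fun z => ⟨n, by
      by_contra h
      exact absurd (T.extV_lt_n i (Subtype.prop _) (fun e => h (Subtype.ext e)))
        (not_lt.mpr (key z n))⟩
    v := fun z => T.extV z.1
    v_lt_v_par := fun z => T.extV_lt i z.2
    v_lt := fun z hz => T.extV_lt_n i z.2 (fun e => hz (Subtype.ext e)) }

/-- The inclusion of valuated trees `γ : T → Tᵢ`. -/
def incl (T : ValTree.{u} n) (i : ℕ) : T ⟶ T.stage i where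
  toFun x := ⟨.inl x, T.inl_mem_stageSet i x⟩
  map_par _ := rfl
  le_v _ := le_rfl


theorem mem_relations (p : ℕ) (T : ValTree.{u} n) {b : T.carrier →₀ ℤ}
    (hb : b ∈ T.relations p) :
    ∃ (c : T.carrier →₀ ℤ) (d : ℤ),
      b = (p : ℤ) • c - Finsupp.mapDomain T.par c + Finsupp.single T.root d := by
  induction hb using AddSubgroup.closure_induction with
  | mem b h =>
    rcases h with ⟨x, rfl⟩ | rfl
    · exact ⟨Finsupp.single x 1, 0, by simp [Finsupp.mapDomain_single]⟩
    · exact ⟨0, 1, by simp⟩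
  | zero => exact ⟨0, 0, by simp⟩
  | add b b' _ _ h h' =>
    obtain ⟨c, d, rfl⟩ := h
    obtain ⟨c', d', rfl⟩ := h'
    refine ⟨c + c', d + d', ?_⟩
    rw [Finsupp.mapDomain_add, Finsupp.single_add, smul_add]
    abel
  | neg b _ h =>
    obtain ⟨c, d, rfl⟩ := h
    refine ⟨-c, -d, ?_⟩
    have : Finsupp.mapDomain T.par (-c) = -Finsupp.mapDomain T.par c :=
      map_neg (Finsupp.mapDomain.addMonoidHom T.par) c
    rw [this, Finsupp.single_neg, smul_neg]
    abel

theorem rel_mem (p : ℕ) (T : ValTree.{u} n) (c : T.carrier →₀ ℤ) (d : ℤ) :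
    (p : ℤ) • c - Finsupp.mapDomain T.par c + Finsupp.single T.root d ∈ T.relations p := by
  refine add_mem ?_ ?_
  · induction c using Finsupp.induction_linear with
    | zero => simp
    | add f g hf hg =>
      have := add_mem hf hg
      rw [Finsupp.mapDomain_add, smul_add]
      convert this using 1
      abel
    | single x k =>
      have : (p : ℤ) • Finsupp.single x k - Finsupp.mapDomain T.par (Finsupp.single x k) =
          k • ((p : ℤ) • Finsupp.single x 1 - Finsupp.single (T.par x) 1) := by
        simp [Finsupp.mapDomain_single, smul_sub, mul_comm]
      rw [this]
      exact (T.relations p).zsmul_mem (AddSubgroup.subset_closure (Or.inl ⟨x, rfl⟩)) k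
  · have : Finsupp.single T.root d = d • Finsupp.single T.root (1 : ℤ) := by simp
    rw [this]
    exact (T.relations p).zsmul_mem (AddSubgroup.subset_closure (Or.inr rfl)) d

theorem mapDomain_apply_eq_zero {α β : Type u} (g : α → β) (c : α →₀ ℤ) (w : β)
    (h : ∀ a, g a = w → c a = 0) : Finsupp.mapDomain g c w = 0 := by
  rw [Finsupp.mapDomain, Finsupp.sum_apply]
  refine Finset.sum_eq_zero fun a _ => ?_
  by_cases ha : g a = w
  · simp [h a ha]
  · simp [ha]

theorem incl_injective (T : ValTree.{u} n) (i : ℕ) : Function.Injective (T.incl i).toFun :=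
  fun _ _ h => Sum.inl_injective (congrArg Subtype.val h)

/-- `S(γ) : S(T) → S(Tᵢ)` is injective. -/
theorem mapS_incl_injective (p : ℕ) (hp : p ≠ 0) (T : ValTree.{u} n) (i : ℕ) :
    Function.Injective (mapS p (T.incl i)) := by
  rw [injective_iff_map_eq_zero]
  intro b hb
  obtain ⟨b, rfl⟩ := T.mkS_surjective p b
  replace hb : (T.stage i).mkS p (Finsupp.mapDomain (T.incl i).toFun b) = 0 := hb
  rw [mkS_eq_zero_iff] at hb
  obtain ⟨c, d, hcd⟩ := mem_relations p _ hb
  have key : ∀ z : (T.stage i).carrier, (∀ x, (T.incl i).toFun x ≠ z) →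
      (∀ y, (T.stage i).par y = z → c y = 0) → c z = 0 := by
    intro z hz hy
    have h0 : Finsupp.single (T.stage i).root d z = 0 := by
      classical
      rw [Finsupp.single_apply]
      exact if_neg (hz T.root)
    have e := DFunLike.congr_fun hcd z
    rw [mapDomain_apply_eq_zero _ _ _ (fun a ha => absurd ha (hz a)), Finsupp.add_apply,
      Finsupp.sub_apply, mapDomain_apply_eq_zero _ _ _ hy,
      h0] at e
    simpa [hp] using e.symm
  have hc : ∀ (m : ℕ) (x : T.carrier) (z : (T.stage i).carrier),
      z.1 = .inr (x, m) → c z = 0 := by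
    intro m
    induction m with
    | zero =>
      intro x z hz
      refine key z (fun y h => ?_) (fun y h => ?_)
      · subst h; cases hz
      · subst h
        replace hz : T.extPar y.1 = .inr (x, 0) := hz
        rcases y with ⟨y | ⟨y, k⟩, hy⟩
        · cases hz
        · simp only [extPar] at hz
          split_ifs at hz
          simp at hz
    | succ m ih =>
      intro x z hz
      refine key z (fun y h => ?_) (fun y h => ?_)
      · subst h; cases hz
      · subst h
        replace hz : T.extPar y.1 = .inr (x, m + 1) := hz
        rcases y with ⟨y | ⟨y, k⟩, hy⟩
        · cases hz
        · simp only [extPar] at hz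
          split_ifs at hz
          simp only [Sum.inr.injEq, Prod.mk.injEq, Nat.add_right_cancel_iff] at hz
          obtain ⟨rfl, rfl⟩ := hz
          exact ih y _ rfl
  have hinj := T.incl_injective i
  let c' : T.carrier →₀ ℤ := Finsupp.comapDomain (T.incl i).toFun c hinj.injOn
  have hc' : Finsupp.mapDomain (T.incl i).toFun c' = c := by
    refine Finsupp.mapDomain_comapDomain _ hinj c ?_
    intro z hz
    obtain ⟨z, hz'⟩ := z
    rcases z with x | ⟨x, m⟩
    · exact ⟨x, rfl⟩
    · exact absurd (hc m x ⟨_, hz'⟩ rfl) (Finsupp.mem_support_iff.1 hz)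
  have hb' : b = (p : ℤ) • c' - Finsupp.mapDomain T.par c' + Finsupp.single T.root d := by
    refine Finsupp.mapDomain_injective hinj ?_
    have e : Finsupp.mapDomain (T.incl i).toFun (Finsupp.mapDomain T.par c') =
        Finsupp.mapDomain (T.stage i).par c := by
      rw [← hc', ← Finsupp.mapDomain_comp, ← Finsupp.mapDomain_comp]
      rfl
    have e' : ∀ a : T.carrier →₀ ℤ, Finsupp.mapDomain (T.incl i).toFun a =
      Finsupp.mapDomain.addMonoidHom (T.incl i).toFun a := fun _ => rfl
    have e'' : Finsupp.mapDomain (T.incl i).toFun (Finsupp.single T.root d) =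
        Finsupp.single (T.stage i).root d := Finsupp.mapDomain_single
    rw [hcd, ← e, ← e'', ← hc']
    simp only [e', map_add, map_sub, map_zsmul]
  rw [mkS_eq_zero_iff, hb']
  exact T.rel_mem p c' d

end ValTree

/-! ### The submodule category -/

/-- An object of `sub(R)`: a monomorphism `M₁ → M₂` of finitely generated `R`-modules. -/
structure SubRep (R : Type w) [Ring R] where
  M₁ : Type u
  M₂ : Type u
  [addCommGroup₁ : AddCommGroup M₁]
  [addCommGroup₂ : AddCommGroup M₂]
  [module₁ : Module R M₁]
  [module₂ : Module R M₂]
  [finite₁ : Module.Finite R M₁]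
  [finite₂ : Module.Finite R M₂]
  f : M₁ →ₗ[R] M₂
  injective : Function.Injective f

namespace SubRep

attribute [instance] addCommGroup₁ addCommGroup₂ module₁ module₂ finite₁ finite₂

variable {R : Type w} [Ring R]

/-- Morphisms of representations: commutative squares. -/
@[ext]
structure Hom (M N : SubRep.{u} R) where
  φ₁ : M.M₁ →ₗ[R] N.M₁
  φ₂ : M.M₂ →ₗ[R] N.M₂
  comm : φ₂ ∘ₗ M.f = N.f ∘ₗ φ₁

/-- The category `sub(R)`. -/
instance : Category (SubRep.{u} R) where
  Hom := Hom
  id M := ⟨LinearMap.id, LinearMap.id, rfl⟩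
  comp g h := ⟨h.φ₁ ∘ₗ g.φ₁, h.φ₂ ∘ₗ g.φ₂, by
    rw [LinearMap.comp_assoc, g.comm, ← LinearMap.comp_assoc, h.comm, LinearMap.comp_assoc]⟩

section

variable {M N P : SubRep.{u} R}

@[ext]
theorem hom_ext {g h : M ⟶ N} (h₁ : g.φ₁ = h.φ₁) (h₂ : g.φ₂ = h.φ₂) : g = h :=
  Hom.ext h₁ h₂

instance : Zero (M ⟶ N) := ⟨⟨0, 0, by simp⟩⟩
instance : Add (M ⟶ N) := ⟨fun g h => ⟨g.φ₁ + h.φ₁, g.φ₂ + h.φ₂, by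
  rw [LinearMap.add_comp, LinearMap.comp_add, g.comm, h.comm]⟩⟩
instance : Neg (M ⟶ N) := ⟨fun g => ⟨-g.φ₁, -g.φ₂, by
  rw [LinearMap.neg_comp, LinearMap.comp_neg, g.comm]⟩⟩

@[simp] theorem zero_φ₁ : (0 : M ⟶ N).φ₁ = 0 := rfl
@[simp] theorem zero_φ₂ : (0 : M ⟶ N).φ₂ = 0 := rfl
@[simp] theorem add_φ₁ (g h : M ⟶ N) : (g + h).φ₁ = g.φ₁ + h.φ₁ := rfl
@[simp] theorem add_φ₂ (g h : M ⟶ N) : (g + h).φ₂ = g.φ₂ + h.φ₂ := rfl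
@[simp] theorem neg_φ₁ (g : M ⟶ N) : (-g).φ₁ = -g.φ₁ := rfl
@[simp] theorem neg_φ₂ (g : M ⟶ N) : (-g).φ₂ = -g.φ₂ := rfl
@[simp] theorem id_φ₁ : (𝟙 M : M ⟶ M).φ₁ = LinearMap.id := rfl
@[simp] theorem id_φ₂ : (𝟙 M : M ⟶ M).φ₂ = LinearMap.id := rfl
@[simp] theorem comp_φ₁ (g : M ⟶ N) (h : N ⟶ P) : (g ≫ h).φ₁ = h.φ₁ ∘ₗ g.φ₁ := rfl
@[simp] theorem comp_φ₂ (g : M ⟶ N) (h : N ⟶ P) : (g ≫ h).φ₂ = h.φ₂ ∘ₗ g.φ₂ := rfl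

instance : AddCommGroup (M ⟶ N) where
  add_assoc _ _ _ := by ext <;> simp [add_assoc]
  zero_add _ := by ext <;> simp
  add_zero _ := by ext <;> simp
  add_comm _ _ := by ext <;> simp [add_comm]
  neg_add_cancel _ := by ext <;> simp
  nsmul := nsmulRec
  zsmul := zsmulRec

end

instance : Preadditive (SubRep.{u} R) where
  add_comp _ _ _ _ _ _ := by ext <;> simp
  comp_add _ _ _ _ _ _ := by ext <;> simp

/-- The direct sum of a finite family of objects of `sub(R)`, formed componentwise. -/
def pi {J : Type} [Finite J] (F : J → SubRep.{u} R) : SubRep.{u} R where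
  M₁ := ∀ j, (F j).M₁
  M₂ := ∀ j, (F j).M₂
  f := LinearMap.pi fun j => (F j).f ∘ₗ LinearMap.proj j
  injective _ _ h := funext fun j => (F j).injective (congrFun h j)

/-- The projections of the componentwise direct sum. -/
def piProj {J : Type} [Finite J] (F : J → SubRep.{u} R) (j : J) : pi F ⟶ F j :=
  { φ₁ := LinearMap.proj (φ := fun j => (F j).M₁) j
    φ₂ := LinearMap.proj (φ := fun j => (F j).M₂) j
    comm := rfl }

open Classical in
/-- The injections of the componentwise direct sum. -/
def piIncl {J : Type} [Finite J] (F : J → SubRep.{u} R) (j : J) : F j ⟶ pi F :=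
  { φ₁ := LinearMap.single R (fun j => (F j).M₁) j
    φ₂ := LinearMap.single R (fun j => (F j).M₂) j
    comm := by
      refine LinearMap.ext fun x => funext fun k => ?_
      change (Pi.single j ((F j).f x) : ∀ j, (F j).M₂) k =
        (F k).f ((Pi.single j x : ∀ j, (F j).M₁) k)
      by_cases h : k = j
      · subst h; simp
      · simp [h] }

theorem piIncl_proj_self {J : Type} [Finite J] (F : J → SubRep.{u} R) (j : J) :
    piIncl F j ≫ piProj F j = 𝟙 (F j) := by
  classical
  refine hom_ext (LinearMap.ext fun x => ?_) (LinearMap.ext fun x => ?_)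
  · change (Pi.single j x : ∀ j, (F j).M₁) j = x
    simp
  · change (Pi.single j x : ∀ j, (F j).M₂) j = x
    simp

theorem piIncl_proj_ne {J : Type} [Finite J] (F : J → SubRep.{u} R) {j k : J} (h : j ≠ k) :
    piIncl F j ≫ piProj F k = 0 := by
  classical
  refine hom_ext (LinearMap.ext fun x => ?_) (LinearMap.ext fun x => ?_)
  · change (Pi.single j x : ∀ j, (F j).M₁) k = 0
    simp [Ne.symm h]
  · change (Pi.single j x : ∀ j, (F j).M₂) k = 0
    simp [Ne.symm h]

open Classical in
/-- The componentwise direct sum with its projections and injections. -/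
def piBicone {J : Type} [Finite J] (F : J → SubRep.{u} R) : Bicone F where
  pt := pi F
  π := piProj F
  ι := piIncl F
  ι_π j k := by
    by_cases h : j = k
    · subst h
      simpa using piIncl_proj_self F j
    · simpa [h] using piIncl_proj_ne F h

/-- The componentwise direct sum is a biproduct in `sub(R)`. -/
def piBiconeIsBilimit {J : Type} [Fintype J] (F : J → SubRep.{u} R) :
    (piBicone F).IsBilimit :=
  isBilimitOfTotal _ (by
    classical
    let e₁ : (pi F ⟶ pi F) →+ ((pi F).M₁ →ₗ[R] (pi F).M₁) :=
      { toFun := fun g => g.φ₁, map_zero' := rfl, map_add' := fun _ _ => rfl }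
    let e₂ : (pi F ⟶ pi F) →+ ((pi F).M₂ →ₗ[R] (pi F).M₂) :=
      { toFun := fun g => g.φ₂, map_zero' := rfl, map_add' := fun _ _ => rfl }
    refine hom_ext ?_ ?_
    · change e₁ (∑ j, piProj F j ≫ piIncl F j) = LinearMap.id
      rw [map_sum]
      refine LinearMap.ext fun x => ?_
      rw [LinearMap.sum_apply]
      exact Finset.univ_sum_single (M := fun j => (F j).M₁) x
    · change e₂ (∑ j, piProj F j ≫ piIncl F j) = LinearMap.id
      rw [map_sum]
      refine LinearMap.ext fun x => ?_
      rw [LinearMap.sum_apply]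
      exact Finset.univ_sum_single (M := fun j => (F j).M₂) x)

instance : HasFiniteBiproducts (SubRep.{u} R) where
  out _ := { has_biproduct := fun F => ⟨⟨piBicone F, piBiconeIsBilimit F⟩⟩ }

instance : HasBinaryBiproducts (SubRep.{u} R) := hasBinaryBiproducts_of_finite_biproducts _

end SubRep

/-- The representation `M_T = (S(γ) : S(T) → S(Tₙ₋₁))` in `sub(ℤ/(p ^ n))`. -/
def ValTree.M (p : ℕ) [Fact p.Prime] {n : ℕ} (T : ValTree.{u} n) : SubRep.{u} (ZMod (p ^ n)) where
  M₁ := T.S p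
  M₂ := (T.stage (n - 1)).S p
  f := ValTree.mapS p (T.incl (n - 1))
  injective := T.mapS_incl_injective p (Fact.out (p := p.Prime)).ne_zero (n - 1)

end

noncomputable section

namespace ValTree

variable {n : ℕ}

/-! In `Tₙ₋₁` the value of an element is its height, so the filtration of `S(Tₙ₋₁)` by values is the
`p`-adic one, and it induces on `S(T)` the filtration by values (`mem_filt_iff`). Hence every
morphism `M_T ⟶ M_T'` restricts to a valuated homomorphism `S(T) → S(T')`. Conversely, each valuated
homomorphism extends (`Valuated.exists_extension`), and an endomorphism of `M_T` that is the
identity on `S(T)` is an automorphism (`M_isMinimal`). Questions about `M_T` up to isomorphism thus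
become questions about the valuated group `S(T)`.

These are answered by coefficients. For a valuated `f`, the relation "`f [x]` has nonzero
coefficient at `y`" is a simulation (`Valuated.isSimulation`), so it yields tree morphisms. In an
irretractable tree, a simulation between siblings forces equality (`Irretractable.eq_of_sim`).
Therefore a closed walk of nonzero coefficients can be pushed up to the unique top `x`
(`Valuated.coeff_top_of_cycle`), and an endomorphism whose coefficient at the top is nonzero is
injective. That coefficient is an additive functional showing that the endomorphism ring of `M_T` is
local (`hasLocalFunctional_M`). An isomorphism `M_T ≅ M_T'` gives tree morphisms in both directions
matching the tops, and an endomorphism fixing the top is the identity.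

Conversely, an idempotent `r` splits `M_T` into the representations of the fixed tree and of the
quotient tree (`nonempty_iso_biprod_of_idem`). Induction on the size of `T` gives existence of
decompositions, and the Krull–Schmidt argument `exists_equiv_of_iso` gives uniqueness. -/

instance (T : ValTree.{u} n) : Fintype T.carrier := Fintype.ofFinite _

/-! ### Valuations and iterated parents -/

theorem par_iterate_add (T : ValTree.{u} n) (s t : ℕ) (x : T.carrier) :
    T.par^[s] (T.par^[t] x) = T.par^[s + t] x :=
  (Function.iterate_add_apply _ _ _ _).symm

theorem v_lt_par (T : ValTree.{u} n) {x : T.carrier} (hx : x ≠ T.root) : T.v x < T.v (T.par x) :=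
  (T.v_lt_v_par x).resolve_right fun h => absurd (T.v_lt x hx) (by simp [h.1])

theorem v_le_par (T : ValTree.{u} n) (x : T.carrier) : T.v x ≤ T.v (T.par x) := by
  rcases T.v_lt_v_par x with h | h
  · exact h.le
  · rw [h.1, h.2]

theorem v_ne_top (T : ValTree.{u} n) {x : T.carrier} (hx : x ≠ T.root) : T.v x ≠ ⊤ :=
  (lt_top_of_lt (T.v_lt x hx)).ne

theorem exists_v_eq (T : ValTree.{u} n) {x : T.carrier} (hx : x ≠ T.root) :
    ∃ i : ℕ, T.v x = i ∧ i < n := by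
  obtain ⟨i, hi⟩ := ENat.ne_top_iff_exists.1 (T.v_ne_top hx)
  refine ⟨i, hi.symm, ?_⟩
  have := T.v_lt x hx
  rw [← hi] at this
  exact_mod_cast this

theorem add_le_v_par (T : ValTree.{u} n) {x : T.carrier} {k : ℕ} (h : (k : ℕ∞) ≤ T.v x) :
    ((k + 1 : ℕ) : ℕ∞) ≤ T.v (T.par x) := by
  rcases T.v_lt_v_par x with h' | h'
  · exact_mod_cast Order.add_one_le_of_lt (h.trans_lt h')
  · simp [h'.2]

theorem v_le_iterate (T : ValTree.{u} n) (x : T.carrier) (t : ℕ) :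
    T.v x ≤ T.v (T.par^[t] x) := by
  induction t with
  | zero => simp
  | succ t ih =>
    rw [Function.iterate_succ_apply']
    exact ih.trans (T.v_le_par _)

theorem ne_root_of_iterate (T : ValTree.{u} n) {x y : T.carrier} {t : ℕ}
    (h : T.par^[t] x = y) (hy : y ≠ T.root) : x ≠ T.root := by
  rintro rfl
  exact hy (by rw [← h, T.iterate_root])

theorem v_lt_iterate (T : ValTree.{u} n) {x : T.carrier} (hx : x ≠ T.root) {t : ℕ} (ht : t ≠ 0) :
    T.v x < T.v (T.par^[t] x) := by
  obtain ⟨t, rfl⟩ := Nat.exists_eq_succ_of_ne_zero ht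
  rw [Function.iterate_succ_apply]
  exact (T.v_lt_par hx).trans_le (T.v_le_iterate _ t)

theorem eq_of_iterate_of_v_le (T : ValTree.{u} n) {x y : T.carrier} (hy : y ≠ T.root) {t : ℕ}
    (h : T.par^[t] x = y) (hv : T.v y ≤ T.v x) : t = 0 := by
  by_contra ht
  have := T.v_lt_iterate (T.ne_root_of_iterate h hy) ht
  rw [h] at this
  exact absurd hv (not_le.2 this)

theorem iterate_eq_self (T : ValTree.{u} n) {x : T.carrier} (hx : x ≠ T.root) {t : ℕ}
    (h : T.par^[t] x = x) : t = 0 :=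
  T.eq_of_iterate_of_v_le hx h le_rfl

theorem iterate_unique (T : ValTree.{u} n) {x y : T.carrier} (hy : y ≠ T.root) {s t : ℕ}
    (hs : T.par^[s] x = y) (ht : T.par^[t] x = y) : s = t := by
  wlog hst : s ≤ t generalizing s t
  · exact (this ht hs (not_le.1 hst).le).symm
  obtain ⟨d, rfl⟩ := Nat.exists_eq_add_of_le hst
  rw [add_comm, ← T.par_iterate_add, hs] at ht
  rw [T.iterate_eq_self hy ht, add_zero]

/-! ### The universal property of `S(T)` -/

/-- The homomorphism `S(T) → G` defined by its values on the classes of the elements of `T`. -/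
def lift (p : ℕ) (T : ValTree.{u} n) {G : Type*} [AddCommGroup G] (φ : T.carrier → G)
    (hroot : φ T.root = 0) (hpar : ∀ x, p • φ x = φ (T.par x)) : T.S p →+ G :=
  QuotientAddGroup.lift (T.relations p)
    (Finsupp.liftAddHom fun x => (zmultiplesHom G (φ x))) (by
      rw [relations, AddSubgroup.closure_le]
      rintro _ (⟨x, rfl⟩ | rfl)
      · change Finsupp.liftAddHom (fun x => (zmultiplesHom G (φ x))) _ = 0
        rw [map_sub, map_zsmul]
        simp [← hpar]
      · change Finsupp.liftAddHom (fun x => (zmultiplesHom G (φ x))) _ = 0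
        simp [hroot])

@[simp] theorem lift_cls (p : ℕ) (T : ValTree.{u} n) {G : Type*} [AddCommGroup G]
    (φ : T.carrier → G) (hroot : φ T.root = 0) (hpar : ∀ x, p • φ x = φ (T.par x))
    (x : T.carrier) : T.lift p φ hroot hpar (T.cls p x) = φ x := by
  change Finsupp.liftAddHom (fun x => (zmultiplesHom G (φ x))) (Finsupp.single x 1) = φ x
  simp

theorem addHom_ext {p : ℕ} {T : ValTree.{u} n} {G : Type*} [AddCommGroup G] {f g : T.S p →+ G}
    (h : ∀ x, f (T.cls p x) = g (T.cls p x)) : f = g := by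
  ext b
  induction b using S_induction with
  | h0 => simp
  | hadd a b ha hb => rw [map_add, map_add, ha, hb]
  | hcls k x => rw [map_zsmul, map_zsmul, h]

theorem exists_sum_cls {p : ℕ} {T : ValTree.{u} n} (a : T.S p) :
    ∃ b : T.carrier → ℤ, a = ∑ x, b x • T.cls p x := by
  classical
  induction a using S_induction with
  | h0 => exact ⟨0, by simp⟩
  | hadd a b ha hb =>
    obtain ⟨f, rfl⟩ := ha
    obtain ⟨g, rfl⟩ := hb
    exact ⟨f + g, by simp [add_smul, Finset.sum_add_distrib]⟩
  | hcls k x => exact ⟨fun y => if y = x then k else 0, by simp [ite_smul]⟩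

theorem mapS_cls (p : ℕ) {T T' : ValTree.{u} n} (f : T ⟶ T') (x : T.carrier) :
    mapS p f (T.cls p x) = T'.cls p (f.toFun x) := by
  change T'.mkS p (Finsupp.mapDomain f.toFun (Finsupp.single x 1)) = _
  rw [Finsupp.mapDomain_single]
  rfl

theorem hom_root {T T' : ValTree.{u} n} (f : T ⟶ T') : f.toFun T.root = T'.root := by
  obtain ⟨k, hk⟩ := T'.exists_iterate (f.toFun T.root)
  have h : T'.par (f.toFun T.root) = f.toFun T.root := by rw [← f.map_par, T.par_root]
  rw [← hk, Function.iterate_fixed h k]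

theorem hom_iterate {T T' : ValTree.{u} n} (f : T ⟶ T') (t : ℕ) (x : T.carrier) :
    f.toFun (T.par^[t] x) = T'.par^[t] (f.toFun x) := by
  induction t generalizing x with
  | zero => rfl
  | succ t ih => rw [Function.iterate_succ_apply, ih, f.map_par, Function.iterate_succ_apply]

/-! ### Coefficients -/

section Coeff

variable (p : ℕ) (T : ValTree.{u} n)

open Classical in
/-- The coefficient at `y` of an element of `S(T)`, with `[z]` counted as `p⁻ᵗ [y]` if
`par^[t] z = y`; values are scaled by `p ^ (n - 1)`. -/
def coeff (y : T.carrier) : T.S p →+ ZMod (p ^ n) :=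
  T.lift p
    (fun z => if y = T.root then 0 else
      ∑ t ∈ Finset.range n, if T.par^[t] z = y then (p : ZMod (p ^ n)) ^ (n - 1 - t) else 0)
    (by
      split_ifs with hy
      · rfl
      · exact Finset.sum_eq_zero fun t _ => if_neg (by rw [T.iterate_root]; exact Ne.symm hy))
    (fun x => by
      split_ifs with hy
      · simp
      · rcases n with _ | n
        · exact absurd (T.iterate_eq_root y) hy
        -- With exponent `n + 1`, the term `t = 0` of `[x]` dies because `p * p ^ n = 0`, and the
        -- last term of `[par x]` vanishes because the `(n + 1)`-st parent of `x` is the root. The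
        -- remaining terms agree after a shift by one.
        rw [Finset.sum_range_succ', Finset.sum_range_succ (fun t => if T.par^[t] (T.par x) = y
          then _ else _), if_neg (c := T.par^[n] (T.par x) = y), add_zero, smul_add,
          Finset.smul_sum]
        · have h0 : p • (if T.par^[0] x = y then (p : ZMod (p ^ (n + 1))) ^ (n + 1 - 1 - 0)
              else 0) = 0 := by
            split_ifs
            · have := ZMod.natCast_self (p ^ (n + 1))
              simpa [nsmul_eq_mul, pow_succ'] using this
            · simp
          rw [h0, add_zero]
          refine Finset.sum_congr rfl fun t ht => ?_
          rw [Finset.mem_range] at ht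
          rw [Function.iterate_succ_apply]
          split_ifs
          · rw [nsmul_eq_mul, ← pow_succ']
            congr 1
            omega
          · simp
        · rw [← Function.iterate_succ_apply, T.iterate_eq_root]
          exact Ne.symm hy)

open Classical in
theorem coeff_cls (y z : T.carrier) (hy : y ≠ T.root) : T.coeff p y (T.cls p z) =
    ∑ t ∈ Finset.range n, if T.par^[t] z = y then (p : ZMod (p ^ n)) ^ (n - 1 - t) else 0 := by
  rw [coeff, lift_cls, if_neg hy]

@[simp] theorem coeff_root : T.coeff p T.root = 0 :=
  addHom_ext fun x => by rw [coeff, lift_cls, if_pos rfl, AddMonoidHom.zero_apply]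

variable {p T}

theorem ne_root_of_coeff {y : T.carrier} {a : T.S p} (h : T.coeff p y a ≠ 0) : y ≠ T.root := by
  rintro rfl
  simp at h

theorem exists_iterate_of_coeff {y z : T.carrier} (h : T.coeff p y (T.cls p z) ≠ 0) :
    ∃ t < n, T.par^[t] z = y := by
  rw [T.coeff_cls p y z (ne_root_of_coeff h)] at h
  obtain ⟨t, ht, h⟩ := Finset.exists_ne_zero_of_sum_ne_zero h
  exact ⟨t, Finset.mem_range.1 ht, by by_contra h'; simp [h'] at h⟩

theorem coeff_self {y : T.carrier} (hy : y ≠ T.root) :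
    T.coeff p y (T.cls p y) = (p : ZMod (p ^ n)) ^ (n - 1) := by
  rw [T.coeff_cls p y y hy, Finset.sum_eq_single 0]
  · simp
  · exact fun t _ ht => if_neg fun h => ht (T.iterate_eq_self hy h)
  · intro h
    rcases n with _ | n
    · exact absurd (T.iterate_eq_root y) hy
    · simp at h

open Classical in
-- Reaching `y` in `t + 1` steps means reaching exactly one child of `y` in `t` steps. This identity
-- is the link between multiplication by `p` and the shape of the tree.
theorem nsmul_coeff {y : T.carrier} (hy : y ≠ T.root) (a : T.S p) :
    p • T.coeff p y a = ∑ w with T.par w = y, T.coeff p w a := by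
  have : (T.coeff p y).comp (nsmulAddMonoidHom p) = ∑ w with T.par w = y, T.coeff p w := by
    refine addHom_ext fun z => ?_
    rw [AddMonoidHom.comp_apply, nsmulAddMonoidHom_apply, nsmul_cls, T.coeff_cls p y _ hy,
      AddMonoidHom.finsetSum_apply]
    have : ∀ w ∈ Finset.univ.filter (fun w => T.par w = y), T.coeff p w (T.cls p z) =
        ∑ t ∈ Finset.range n,
          if T.par^[t] z = w then (p : ZMod (p ^ n)) ^ (n - 1 - t) else 0 := by
      intro w hw
      refine T.coeff_cls p w z ?_
      rintro rfl
      rw [Finset.mem_filter, T.par_root] at hw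
      exact hy hw.2.symm
    rw [Finset.sum_congr rfl this, Finset.sum_comm]
    refine Finset.sum_congr rfl fun t _ => ?_
    rw [Finset.sum_ite_eq, ← Function.iterate_succ_apply, Function.iterate_succ_apply']
    simp
  have h := DFunLike.congr_fun this a
  rw [AddMonoidHom.comp_apply, nsmulAddMonoidHom_apply, map_nsmul,
    AddMonoidHom.finsetSum_apply] at h
  exact h

theorem exists_child_of_coeff {y : T.carrier} {a : T.S p} (h : p • T.coeff p y a ≠ 0) :
    ∃ w, T.par w = y ∧ T.coeff p w a ≠ 0 := by
  classical
  have hy : y ≠ T.root := by rintro rfl; simp at h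
  rw [nsmul_coeff hy] at h
  obtain ⟨w, hw, h⟩ := Finset.exists_ne_zero_of_sum_ne_zero h
  exact ⟨w, (Finset.mem_filter.1 hw).2, h⟩

theorem nsmul_coeff_par {w : T.carrier} {a : T.S p} (hw : T.par w ≠ T.root)
    (h : ∀ w', T.par w' = T.par w → w' ≠ w → T.coeff p w' a = 0) :
    p • T.coeff p (T.par w) a = T.coeff p w a := by
  classical
  rw [nsmul_coeff hw]
  refine Finset.sum_eq_single w (fun w' hw' hne => h w' (Finset.mem_filter.1 hw').2 hne) ?_
  intro h
  simp at h

/-! ### Multiples of `p ^ (n - 1)` in `ℤ/(p ^ n)` -/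

theorem pow_ne_zero_zmod [Fact p.Prime] (hn : 0 < n) : (p : ZMod (p ^ n)) ^ (n - 1) ≠ 0 := by
  have hp := (Fact.out : p.Prime)
  rw [← Nat.cast_pow, Ne, ZMod.natCast_eq_zero_iff]
  intro h
  have := (Nat.pow_dvd_pow_iff_le_right hp.one_lt).1 h
  omega

/-- An element of `ℤ/(p ^ n)` killed by `p` is a multiple of `p ^ (n - 1)`. -/
theorem exists_eq_mul_pow [Fact p.Prime] (hn : 0 < n) {c : ZMod (p ^ n)} (hc : p • c = 0) :
    ∃ j : ℤ, c = j • (p : ZMod (p ^ n)) ^ (n - 1) := by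
  have hp := (Fact.out : p.Prime)
  obtain ⟨k, rfl⟩ := ZMod.intCast_surjective c
  have h : ((p * k : ℤ) : ZMod (p ^ n)) = 0 := by
    rw [← hc]; simp
  rw [ZMod.intCast_zmod_eq_zero_iff_dvd] at h
  obtain ⟨m, rfl⟩ := Nat.exists_eq_succ_of_ne_zero hn.ne'
  push_cast at h
  rw [pow_succ', mul_dvd_mul_iff_left (by exact_mod_cast hp.ne_zero)] at h
  obtain ⟨j, rfl⟩ := h
  exact ⟨j, by simp [mul_comm]⟩

theorem zsmul_pow_eq_zero_iff [Fact p.Prime] (hn : 0 < n) (j : ℤ) :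
    j • (p : ZMod (p ^ n)) ^ (n - 1) = 0 ↔ (p : ℤ) ∣ j := by
  have hp := (Fact.out : p.Prime)
  obtain ⟨m, rfl⟩ := Nat.exists_eq_succ_of_ne_zero hn.ne'
  have : j • (p : ZMod (p ^ (m + 1))) ^ (m + 1 - 1) = ((j * p ^ m : ℤ) : ZMod (p ^ (m + 1))) := by
    simp
  rw [Nat.succ_eq_add_one, this, ZMod.intCast_zmod_eq_zero_iff_dvd]
  push_cast
  rw [pow_succ', mul_dvd_mul_iff_right (pow_ne_zero _ (by exact_mod_cast hp.ne_zero))]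

theorem cls_ne_zero [Fact p.Prime] {x : T.carrier} (hx : x ≠ T.root) : T.cls p x ≠ 0 := by
  intro h
  have hn : 0 < n := by
    rcases n with _ | n
    · exact absurd (T.iterate_eq_root x) hx
    · simp
  have := coeff_self (p := p) hx
  rw [h, map_zero] at this
  exact pow_ne_zero_zmod hn this.symm

end Coeff

/-! ### The filtration of `S(T)` by values -/

section Filt

variable (p : ℕ) (T : ValTree.{u} n)

/-- The subgroup of `S(T)` of all elements of value at least `k`. -/
def filt (k : ℕ) : AddSubgroup (T.S p) :=
  AddSubgroup.closure (T.cls p '' {x | (k : ℕ∞) ≤ T.v x})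

variable {p T}

theorem cls_mem_filt {k : ℕ} {x : T.carrier} (h : (k : ℕ∞) ≤ T.v x) : T.cls p x ∈ T.filt p k :=
  AddSubgroup.subset_closure ⟨x, h, rfl⟩

theorem filt_le {k : ℕ} {H : AddSubgroup (T.S p)}
    (h : ∀ x, (k : ℕ∞) ≤ T.v x → T.cls p x ∈ H) : T.filt p k ≤ H :=
  (AddSubgroup.closure_le _).2 (by rintro _ ⟨x, hx, rfl⟩; exact h x hx)

theorem exists_sum_of_mem_filt {k : ℕ} {a : T.S p} (h : a ∈ T.filt p k) :
    ∃ b : T.carrier → ℤ, a = ∑ x, b x • T.cls p x ∧ ∀ x, b x ≠ 0 → (k : ℕ∞) ≤ T.v x := by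
  classical
  induction h using AddSubgroup.closure_induction with
  | mem a h =>
    obtain ⟨x, hx, rfl⟩ := h
    refine ⟨fun y => if y = x then 1 else 0, by simp [ite_smul], fun y hy => ?_⟩
    have : y = x := by by_contra h; simp [h] at hy
    subst this
    exact hx
  | zero => exact ⟨0, by simp, by simp⟩
  | add a b _ _ ha hb =>
    obtain ⟨f, rfl, hf⟩ := ha
    obtain ⟨g, rfl, hg⟩ := hb
    refine ⟨f + g, by simp [add_smul, Finset.sum_add_distrib], fun x hx => ?_⟩
    by_cases h : f x = 0
    · exact hg x fun h' => hx (by simp [h, h'])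
    · exact hf x h
  | neg a _ ha =>
    obtain ⟨f, rfl, hf⟩ := ha
    exact ⟨-f, by simp, fun x hx => hf x (by simpa using hx)⟩

/-- Values do not decrease under `par`, and `[x]` has nonzero coefficients only at iterated parents
of `x`. -/
theorem coeff_eq_zero_of_mem_filt {k : ℕ} {a : T.S p} (h : a ∈ T.filt p k) {y : T.carrier}
    (hy : T.v y < k) : T.coeff p y a = 0 := by
  have : T.filt p k ≤ (T.coeff p y).ker := filt_le fun x hx => by
    rw [AddMonoidHom.mem_ker]
    by_contra h
    obtain ⟨t, -, rfl⟩ := exists_iterate_of_coeff h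
    exact absurd (hx.trans (T.v_le_iterate x t)) (not_le.2 hy)
  exact this h

/-- The coefficient of a combination of elements of value `≥ k` at an element of value `k`. -/
theorem coeff_sum {k : ℕ} {b : T.carrier → ℤ} (hb : ∀ x, b x ≠ 0 → (k : ℕ∞) ≤ T.v x)
    {y : T.carrier} (hy : T.v y = k) :
    T.coeff p y (∑ x, b x • T.cls p x) = b y • (p : ZMod (p ^ n)) ^ (n - 1) := by
  have hy' : y ≠ T.root := by rintro rfl; simp [T.v_root] at hy
  rw [map_sum, Finset.sum_eq_single y, map_zsmul, coeff_self hy']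
  · intro z _ hz
    rw [map_zsmul]
    by_contra h
    have h1 : b z ≠ 0 := fun h' => h (by simp [h'])
    have h2 : T.coeff p y (T.cls p z) ≠ 0 := fun h' => h (by simp [h'])
    obtain ⟨t, -, ht⟩ := exists_iterate_of_coeff h2
    have := T.eq_of_iterate_of_v_le hy' ht (hy.le.trans (hb z h1))
    subst this
    exact hz ht
  · simp

/-- By induction on `k`: the coefficient at an element `x` of value `k` is `b x • p ^ (n - 1)`. If
it vanishes then `p ∣ b x`, and `b x • [x]` is a multiple of `[par x]`, whose value is larger. So
the coefficients detect the filtration. -/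
theorem mem_filt_of_coeff [Fact p.Prime] (hn : 0 < n) {k : ℕ} {a : T.S p}
    (h : ∀ y, T.v y < k → T.coeff p y a = 0) : a ∈ T.filt p k := by
  induction k with
  | zero =>
    obtain ⟨b, rfl⟩ := exists_sum_cls a
    exact sum_mem fun x _ => zsmul_mem (cls_mem_filt (by simp)) _
  | succ k ih =>
    obtain ⟨b, rfl, hb⟩ := exists_sum_of_mem_filt
      (ih fun y hy => h y (hy.trans_le (by exact_mod_cast Nat.le_succ k)))
    refine sum_mem fun x _ => ?_
    by_cases hbx : b x = 0
    · simp [hbx]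
    rcases (hb x hbx).eq_or_lt with hx | hx
    · have := h x (by rw [← hx]; exact_mod_cast Nat.lt_succ_self k)
      rw [coeff_sum hb hx.symm, zsmul_pow_eq_zero_iff hn] at this
      obtain ⟨c, hc⟩ := this
      rw [hc, mul_comm, mul_smul, natCast_zsmul, nsmul_cls]
      exact zsmul_mem (cls_mem_filt (T.add_le_v_par hx.le)) _
    · exact zsmul_mem (cls_mem_filt (by exact_mod_cast Order.add_one_le_of_lt hx)) _

theorem exists_coeff_ne_zero [Fact p.Prime] (hn : 0 < n) {a : T.S p} (ha : a ≠ 0) :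
    ∃ y, T.coeff p y a ≠ 0 := by
  by_contra! h
  obtain ⟨b, rfl, hb⟩ := exists_sum_of_mem_filt (mem_filt_of_coeff hn (k := n) fun y _ => h y)
  refine ha (Finset.sum_eq_zero fun x _ => ?_)
  by_cases hx : x = T.root
  · rw [hx, cls_root, smul_zero]
  · have : b x = 0 := by
      by_contra hbx
      exact absurd (T.v_lt x hx) (not_lt.2 (hb x hbx))
    rw [this, zero_smul]

/-- The least value of a nonzero element is attained at some coefficient. -/
theorem exists_least_coeff [Fact p.Prime] (hn : 0 < n) {a : T.S p} (ha : a ≠ 0) :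
    ∃ (k : ℕ) (y : T.carrier), T.v y = k ∧ T.coeff p y a ≠ 0 ∧ a ∈ T.filt p k := by
  classical
  have hex : ∃ k : ℕ, ∃ y, T.v y = k ∧ T.coeff p y a ≠ 0 := by
    obtain ⟨y, hy⟩ := exists_coeff_ne_zero hn ha
    obtain ⟨k, hk, -⟩ := T.exists_v_eq (ne_root_of_coeff hy)
    exact ⟨k, y, hk, hy⟩
  obtain ⟨y, hy, hc⟩ := Nat.find_spec hex
  refine ⟨_, y, hy, hc, mem_filt_of_coeff hn fun z hz => ?_⟩
  by_contra h
  obtain ⟨m, hm, -⟩ := T.exists_v_eq (ne_root_of_coeff h)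
  rw [hm] at hz
  exact Nat.find_min hex (by exact_mod_cast hz) ⟨z, hm, h⟩

/-- Homomorphisms that do not decrease values. -/
def Valuated {T T' : ValTree.{u} n} (f : T.S p →+ T'.S p) : Prop :=
  ∀ k, ∀ a ∈ T.filt p k, f a ∈ T'.filt p k

variable {T' T'' : ValTree.{u} n}

theorem Valuated.of_cls {f : T.S p →+ T'.S p}
    (h : ∀ (k : ℕ) x, (k : ℕ∞) ≤ T.v x → f (T.cls p x) ∈ T'.filt p k) : Valuated f :=
  fun k => filt_le (H := (T'.filt p k).comap f) (h k)

theorem Valuated.sub {f g : T.S p →+ T'.S p} (hf : Valuated f) (hg : Valuated g) :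
    Valuated (f - g) :=
  fun k a ha => sub_mem (hf k a ha) (hg k a ha)

theorem Valuated.zsmul {f : T.S p →+ T'.S p} (hf : Valuated f) (j : ℤ) : Valuated (j • f) :=
  fun k a ha => zsmul_mem (hf k a ha) j

theorem Valuated.id : Valuated (AddMonoidHom.id (T.S p)) := fun _ _ ha => ha

theorem Valuated.v_le {f : T.S p →+ T'.S p} (hf : Valuated f) {x : T.carrier} {y : T'.carrier}
    (h : T'.coeff p y (f (T.cls p x)) ≠ 0) : T.v x ≤ T'.v y := by
  have hx : x ≠ T.root := by rintro rfl; simp [cls_root] at h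
  obtain ⟨k, hk, -⟩ := T.exists_v_eq hx
  rw [hk]
  by_contra hlt
  exact h (coeff_eq_zero_of_mem_filt (hf k _ (cls_mem_filt hk.ge)) (not_le.1 hlt))

/-- A nonzero coefficient of least value in `g a` comes from one in `a`. -/
theorem Valuated.exists_coeff [Fact p.Prime] (hn : 0 < n) {g : T'.S p →+ T.S p} (hg : Valuated g)
    {k : ℕ} {a : T'.S p} (ha : a ∈ T'.filt p k) {x : T.carrier} (hx : T.v x = k)
    (h : T.coeff p x (g a) ≠ 0) :
    ∃ y, T'.v y = k ∧ T'.coeff p y a ≠ 0 ∧ T.coeff p x (g (T'.cls p y)) ≠ 0 := by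
  obtain ⟨b, rfl, hb⟩ := exists_sum_of_mem_filt ha
  rw [map_sum, map_sum] at h
  obtain ⟨y, -, hy⟩ := Finset.exists_ne_zero_of_sum_ne_zero h
  rw [map_zsmul, map_zsmul] at hy
  have h1 : b y ≠ 0 := fun h' => hy (by simp [h'])
  have h2 : T.coeff p x (g (T'.cls p y)) ≠ 0 := fun h' => hy (by simp [h'])
  have hv : T'.v y = k := le_antisymm (hx ▸ hg.v_le h2) (hb y h1)
  refine ⟨y, hv, ?_, h2⟩
  rw [coeff_sum hb hv, Ne, zsmul_pow_eq_zero_iff hn]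
  -- If `b y = p * c`, then `g (b y • [y]) = c • g [par y]` has value at least `k + 1`, so its
  -- coefficient at `x` is zero.
  rintro ⟨c, hc⟩
  refine hy ?_
  rw [hc, mul_comm, mul_smul, natCast_zsmul, ← map_nsmul, ← map_nsmul, nsmul_cls,
    coeff_eq_zero_of_mem_filt (k := k + 1), smul_zero]
  · exact hg _ _ (cls_mem_filt (T'.add_le_v_par hv.ge))
  · rw [hx]; exact_mod_cast Nat.lt_succ_self k

end Filt

/-! ### Simulations -/

/-- A relation that allows one to send the elements below `x` to elements below `y` whenever
`R x y` holds. -/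
structure IsSimulation {T T' : ValTree.{u} n} (R : T.carrier → T'.carrier → Prop) : Prop where
  le_v : ∀ {x y}, R x y → T.v x ≤ T'.v y
  exists_child : ∀ {x y w}, R x y → T.par w = x → ∃ w', T'.par w' = y ∧ R w w'

/-- The elements below `x` can be sent to elements below `y`. -/
def Sim {T T' : ValTree.{u} n} (x : T.carrier) (y : T'.carrier) : Prop :=
  ∃ R : T.carrier → T'.carrier → Prop, IsSimulation R ∧ R x y

variable {T T' T'' : ValTree.{u} n}

theorem Sim.refl (x : T.carrier) : Sim x x :=
  ⟨Eq, ⟨fun h => h ▸ le_rfl, fun h h' => ⟨_, h'.trans h, rfl⟩⟩, rfl⟩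

theorem Sim.trans {x : T.carrier} {y : T'.carrier} {z : T''.carrier} (h : Sim x y)
    (h' : Sim y z) : Sim x z := by
  obtain ⟨R, hR, hxy⟩ := h
  obtain ⟨R', hR', hyz⟩ := h'
  refine ⟨fun a c => ∃ b, R a b ∧ R' b c, ⟨?_, ?_⟩, y, hxy, hyz⟩
  · rintro a c ⟨b, h, h'⟩
    exact (hR.le_v h).trans (hR'.le_v h')
  · rintro a c w ⟨b, h, h'⟩ hw
    obtain ⟨w', hw', h₁⟩ := hR.exists_child h hw
    obtain ⟨w'', hw'', h₂⟩ := hR'.exists_child h' hw'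
    exact ⟨w'', hw'', w', h₁, h₂⟩

theorem Sim.of_hom (f : T ⟶ T') (x : T.carrier) : Sim x (f.toFun x) :=
  ⟨fun a b => f.toFun a = b, ⟨fun h => h ▸ f.le_v _,
    fun h h' => ⟨_, by rw [← f.map_par, h', h], rfl⟩⟩, rfl⟩

/-- Since `f [par w] = p • f [w]`, a nonzero coefficient of `f [par w]` at `y` forces one of `f [w]`
at some child of `y`. -/
theorem Valuated.isSimulation {p : ℕ} {f : T.S p →+ T'.S p} (hf : Valuated f) :
    IsSimulation fun x y => T'.coeff p y (f (T.cls p x)) ≠ 0 where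
  le_v h := hf.v_le h
  exists_child {x y w} h hw := by
    subst hw
    rw [← nsmul_cls, map_nsmul, map_nsmul] at h
    exact exists_child_of_coeff h

theorem Valuated.sim {p : ℕ} {f : T.S p →+ T'.S p} (hf : Valuated f) {x : T.carrier}
    {y : T'.carrier} (h : T'.coeff p y (f (T.cls p x)) ≠ 0) : Sim x y :=
  ⟨_, hf.isSimulation, h⟩

/-- A simulation produces a function on the elements below `x`. -/
theorem IsSimulation.exists_fun {R : T.carrier → T'.carrier → Prop} (hR : IsSimulation R)
    {x : T.carrier} {y : T'.carrier} (hx : x ≠ T.root) (h : R x y) :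
    ∃ φ : T.carrier → T'.carrier, φ x = y ∧
      (∀ z t, T.par^[t] z = x → R z (φ z) ∧ T'.par^[t] (φ z) = y) ∧
      ∀ z t, T.par^[t + 1] z = x → φ (T.par z) = T'.par (φ z) := by
  classical
  have : Nonempty T'.carrier := ⟨y⟩
  have hchild : ∀ x y w, R x y → T.par w = x → ∃ w', T'.par w' = y ∧ R w w' :=
    fun _ _ _ => hR.exists_child
  choose! c hc using hchild
  -- `q t` treats the elements `t` steps below `x`, descending from `x ↦ y`. As `x` is not the root,
  -- the distance `t` is determined by the element, so the `q t` glue to `φ`; its value `y`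
  -- elsewhere is irrelevant.
  let q : ℕ → T.carrier → T'.carrier := fun t => Nat.rec (fun _ => y)
    (fun _ q z => c (T.par z) (q (T.par z)) z) t
  have hq : ∀ t z, q (t + 1) z = c (T.par z) (q t (T.par z)) z := fun t z => rfl
  have key : ∀ t z, T.par^[t] z = x → R z (q t z) ∧ T'.par^[t] (q t z) = y := by
    intro t
    induction t with
    | zero => rintro z rfl; exact ⟨h, rfl⟩
    | succ t ih =>
      intro z hz
      obtain ⟨h1, h2⟩ := ih (T.par z) hz
      have := hc _ _ _ h1 rfl
      rw [hq]
      exact ⟨this.2, by rw [Function.iterate_succ_apply, this.1, h2]⟩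
  let φ : T.carrier → T'.carrier := fun z =>
    if hz : ∃ t, T.par^[t] z = x then q (Nat.find hz) z else y
  have hφ : ∀ t z, T.par^[t] z = x → φ z = q t z := by
    intro t z hz
    have hz' : ∃ t, T.par^[t] z = x := ⟨t, hz⟩
    simp only [φ, dif_pos hz']
    rw [T.iterate_unique hx (Nat.find_spec hz') hz]
  refine ⟨φ, hφ 0 x rfl, fun z t hz => ?_, fun z t hz => ?_⟩
  · rw [hφ t z hz]
    exact key t z hz
  · rw [hφ _ z hz, hφ t (T.par z) hz, hq]
    exact (hc _ _ _ (key t (T.par z) hz).1 rfl).1.symm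

/-- A morphism can be changed below `x` by means of a simulation. -/
theorem IsSimulation.exists_hom {R : T.carrier → T'.carrier → Prop} (hR : IsSimulation R)
    {x : T.carrier} {y : T'.carrier} (hx : x ≠ T.root) (h : R x y) (g : T ⟶ T')
    (hg : g.toFun (T.par x) = T'.par y) :
    ∃ φ : T ⟶ T', φ.toFun x = y ∧ (∀ z, (∀ t, T.par^[t] z ≠ x) → φ.toFun z = g.toFun z) ∧
      ∀ z t, T.par^[t] z = x → R z (φ.toFun z) ∧ T'.par^[t] (φ.toFun z) = y := by
  classical
  obtain ⟨φ, h1, h2, h3⟩ := hR.exists_fun hx h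
  have hnot : ∀ t, T.par^[t] (T.par x) ≠ x := fun t ht => by
    rw [← Function.iterate_succ_apply] at ht
    exact absurd (T.iterate_eq_self hx ht) (Nat.succ_ne_zero t)
  refine ⟨⟨fun z => if ∃ t, T.par^[t] z = x then φ z else g.toFun z, fun z => ?_, fun z => ?_⟩,
    ?_, fun z hz => ?_, fun z t hz => ?_⟩
  · by_cases hz : ∃ t, T.par^[t] z = x
    · obtain ⟨t, ht⟩ := hz
      rw [if_pos (c := ∃ t, T.par^[t] z = x) ⟨t, ht⟩]
      rcases t with _ | t
      · obtain rfl : z = x := ht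
        rw [if_neg (by rintro ⟨t, ht⟩; exact hnot t ht), hg, h1]
      · rw [if_pos ⟨t, ht⟩]
        exact h3 z t ht
    · rw [if_neg hz, if_neg, g.map_par]
      rintro ⟨t, ht⟩
      exact hz ⟨t + 1, ht⟩
  · split_ifs with hz
    · obtain ⟨t, ht⟩ := hz
      exact hR.le_v (h2 z t ht).1
    · exact g.le_v z
  · exact (if_pos ⟨0, rfl⟩).trans h1
  · exact if_neg (by rintro ⟨t, ht⟩; exact hz t ht)
  · change R z (ite _ _ _) ∧ T'.par^[t] (ite _ _ _) = y
    rw [if_pos ⟨t, hz⟩]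
    exact h2 z t hz

theorem hom_ext {f g : T ⟶ T'} (h : ∀ x, f.toFun x = g.toFun x) : f = g :=
  Hom.ext (funext h)

/-! ### Irretractable trees -/

/-- Otherwise folding the part below `x` into the part below its sibling `y` is an idempotent that
moves `x` and does not kill `y`. -/
theorem Irretractable.eq_of_sim (hT : T.Irretractable) {x y : T.carrier} (hx : x ≠ T.root)
    (hy : y ≠ T.root) (hxy : T.par x = T.par y) (h : Sim x y) : x = y := by
  by_contra hne
  obtain ⟨R, hR, h⟩ := h
  obtain ⟨φ, h1, h2, h3⟩ := hR.exists_hom hx h (𝟙 T) hxy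
  -- Distinct siblings are not below one another, so the image of the folded part avoids the part
  -- below `x` and is fixed by `φ`.
  have hbelow : ∀ t, T.par^[t] y ≠ x := by
    rintro (_ | t) ht
    · exact hne ht.symm
    · rw [Function.iterate_succ_apply, ← hxy, ← Function.iterate_succ_apply] at ht
      exact absurd (T.iterate_eq_self hx ht) (Nat.succ_ne_zero t)
  have hbelow' : ∀ t, T.par^[t] x ≠ y := by
    rintro (_ | t) ht
    · exact hne ht
    · rw [Function.iterate_succ_apply, hxy, ← Function.iterate_succ_apply] at ht
      exact absurd (T.iterate_eq_self hy ht) (Nat.succ_ne_zero t)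
  have hidem : φ ≫ φ = φ := by
    refine hom_ext fun z => ?_
    change φ.toFun (φ.toFun z) = φ.toFun z
    by_cases hz : ∃ t, T.par^[t] z = x
    · obtain ⟨t, ht⟩ := hz
      have hs := (h3 z t ht).2
      refine h2 _ fun s hsx => ?_
      rcases le_total s t with hst | hst
      · obtain ⟨d, rfl⟩ := Nat.exists_eq_add_of_le hst
        rw [add_comm, ← T.par_iterate_add, hsx] at hs
        exact hbelow' d hs
      · obtain ⟨d, rfl⟩ := Nat.exists_eq_add_of_le hst
        rw [add_comm, ← T.par_iterate_add, hs] at hsx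
        exact hbelow d hsx
    · push Not at hz
      rw [h2 z hz]
      exact h2 z hz
  rcases hT φ hidem with h | h
  · rw [h] at h1
    exact hne h1
  · exact hy (h1 ▸ h x)

/-- Otherwise sending everything below `x` to the root, and fixing the rest, is a forbidden
idempotent: it kills `x` and keeps `z`. Hence a nontrivial irretractable tree has a single top. -/
theorem Irretractable.exists_iterate_eq (hT : T.Irretractable) {x z : T.carrier}
    (hx : x ≠ T.root) (hpar : T.par x = T.root) (hz : z ≠ T.root) : ∃ t, T.par^[t] z = x := by
  by_contra! hzx
  have hR : IsSimulation (fun (_ : T.carrier) (b : T.carrier) => b = T.root) :=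
    ⟨fun h => by rw [h, T.v_root]; exact le_top, fun h _ => ⟨T.root, by rw [h, T.par_root], rfl⟩⟩
  obtain ⟨φ, h1, h2, h3⟩ := hR.exists_hom hx (y := T.root) rfl (𝟙 T) (hpar.trans T.par_root.symm)
  have hidem : φ ≫ φ = φ := by
    refine hom_ext fun w => ?_
    change φ.toFun (φ.toFun w) = φ.toFun w
    by_cases hw : ∃ t, T.par^[t] w = x
    · obtain ⟨t, ht⟩ := hw
      rw [(h3 w t ht).1, hom_root]
    · push Not at hw
      rw [h2 w hw]
      exact h2 w hw
  rcases hT φ hidem with h | h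
  · rw [h] at h1
    exact hx h1
  · exact hz ((h2 z hzx).symm.trans (h z))

theorem Irretractable.eq_of_par_eq_root (hT : T.Irretractable) {x y : T.carrier}
    (hx : x ≠ T.root) (hpx : T.par x = T.root) (hy : y ≠ T.root) (hpy : T.par y = T.root) :
    x = y := by
  obtain ⟨_ | t, ht⟩ := hT.exists_iterate_eq hx hpx hy
  · exact ht.symm
  · rw [Function.iterate_succ_apply, hpy, T.iterate_root] at ht
    exact absurd ht.symm hx

theorem Irretractable.eq_of_v_le (hT : T.Irretractable) {x y : T.carrier}
    (hx : x ≠ T.root) (hpx : T.par x = T.root) (hy : y ≠ T.root) (h : T.v x ≤ T.v y) : y = x := by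
  obtain ⟨t, ht⟩ := hT.exists_iterate_eq hx hpx hy
  obtain rfl := T.eq_of_iterate_of_v_le hx ht h
  exact ht

/-- By descent from the root: if `par z` is fixed, then `z` and `f z` have the same parent and `f`
is a simulation from `z` to `f z`, so they agree. The case `f z = root` is excluded because `z`
would then be the top, hence an iterated parent of the fixed element `x`. -/
theorem Irretractable.eq_id (hT : T.Irretractable) {x : T.carrier} (hx : x ≠ T.root)
    {f : T ⟶ T} (hf : f.toFun x = x) : f = 𝟙 T := by
  have key : ∀ d z, T.par^[d] z = T.root → f.toFun z = z := by
    intro d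
    induction d with
    | zero => rintro z rfl; exact hom_root f
    | succ d ih =>
      intro z hz
      have hpz : T.par z = T.par (f.toFun z) := by rw [← f.map_par, ih (T.par z) hz]
      by_cases hz0 : z = T.root
      · rw [hz0, hom_root]
      by_cases hfz : f.toFun z = T.root
      · rw [hfz, T.par_root] at hpz
        obtain ⟨t, rfl⟩ := hT.exists_iterate_eq hz0 hpz hx
        rw [hom_iterate, hf]
      · exact (hT.eq_of_sim hz0 hfz hpz (Sim.of_hom f z)).symm
  exact hom_ext fun z => key _ z (T.iterate_eq_root z)

theorem exists_par_eq_root (T : ValTree.{u} n) [Nontrivial T.carrier] :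
    ∃ x, x ≠ T.root ∧ T.par x = T.root := by
  classical
  obtain ⟨z, hz⟩ := exists_ne T.root
  have hex := T.exists_iterate z
  obtain ⟨t, ht⟩ := Nat.exists_eq_succ_of_ne_zero (n := Nat.find hex)
    (fun h => hz (by simpa [h] using Nat.find_spec hex))
  refine ⟨T.par^[t] z, Nat.find_min hex (ht ▸ Nat.lt_succ_self t), ?_⟩
  rw [← Function.iterate_succ_apply' T.par, ← ht]
  exact Nat.find_spec hex

/-! ### Endomorphisms of `S(T)` for an irretractable tree -/

section Endo

variable {p : ℕ}

/-- A nonzero coefficient moves up to the parents without cancellation: a sibling `w` of `u` that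
also contributes satisfies `Sim u x` and `Sim x w`, hence `w = u`. -/
theorem Valuated.coeff_par (hT' : T'.Irretractable) {f : T.S p →+ T'.S p} (hf : Valuated f)
    {x : T.carrier} {u : T'.carrier} (h : T'.coeff p u (f (T.cls p x)) ≠ 0) (hs : Sim u x)
    (hu : T'.par u ≠ T'.root) : T'.coeff p (T'.par u) (f (T.cls p (T.par x))) ≠ 0 := by
  rw [← nsmul_cls, map_nsmul, map_nsmul, nsmul_coeff_par hu]
  · exact h
  · intro w hw hne
    by_contra h'
    exact hne (hT'.eq_of_sim (ne_root_of_coeff h) (ne_root_of_coeff h') hw.symm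
      (hs.trans (hf.sim h'))).symm

/-- If `g ∘ f = id` then `f` and `g` have a nonzero coefficient at the tops of the trees. -/
theorem Valuated.coeff_top_of_leftInverse [Fact p.Prime] (hn : 0 < n)
    (hT' : T'.Irretractable) {f : T.S p →+ T'.S p} {g : T'.S p →+ T.S p} (hf : Valuated f)
    (hg : Valuated g) (h : ∀ a, g (f a) = a) {x : T.carrier} (hx : x ≠ T.root)
    (hpx : T.par x = T.root) :
    ∃ u, T'.par u = T'.root ∧ T'.coeff p u (f (T.cls p x)) ≠ 0 ∧
      T.coeff p x (g (T'.cls p u)) ≠ 0 := by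
  obtain ⟨k, hk, -⟩ := T.exists_v_eq hx
  obtain ⟨u, -, h1, h2⟩ := hg.exists_coeff hn (hf k _ (cls_mem_filt hk.ge)) hk
    (by rw [h, coeff_self hx]; exact pow_ne_zero_zmod hn)
  refine ⟨u, ?_, h1, h2⟩
  -- If `u` were not a top, its coefficient would move up to a nonzero coefficient of `f [par x] = f
  -- 0 = 0`.
  by_contra hu
  have := hf.coeff_par hT' h1 (hg.sim h2) hu
  rw [hpx, cls_root, map_zero, map_zero] at this
  exact this rfl

/-- A closed walk in the coefficient graph of `f` forces a nonzero coefficient at the top. -/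
theorem Valuated.coeff_top_of_cycle (hT : T.Irretractable) {f : T.S p →+ T.S p}
    (hf : Valuated f) {x : T.carrier} (hx : x ≠ T.root) (hpx : T.par x = T.root) {k : ℕ}
    (hk : 0 < k) (d : ℕ) (w : ℕ → T.carrier) (hw : ∀ i, w (i + k) = w i)
    (h : ∀ i, T.coeff p (w i) (f (T.cls p (w (i + 1)))) ≠ 0) (hd : T.par^[d] (w 0) = T.root) :
    T.coeff p x (f (T.cls p x)) ≠ 0 := by
  induction d generalizing w with
  | zero => exact absurd hd (ne_root_of_coeff (h 0))
  | succ d ih =>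
    have hsim : ∀ j i, Sim (w (i + j)) (w i) := by
      intro j
      induction j with
      | zero => exact fun i => Sim.refl _
      | succ j ihj => exact fun i => (hf.sim (h (i + j))).trans (ihj i)
    -- Going around the rest of the cycle reverses the simulation.
    have hsim' : ∀ i, Sim (w i) (w (i + 1)) := fun i => by
      have := hsim (k - 1) (i + 1)
      rwa [show i + 1 + (k - 1) = i + k by omega, hw] at this
    -- If the cycle meets the top `x`, the next element has value at least that of `x`, so it is `x`
    -- again. Otherwise the whole cycle is replaced by the cycle of parents, one step closer to the
    -- root.
    by_cases hex : ∃ i, T.par (w i) = T.root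
    · obtain ⟨i, hi⟩ := hex
      obtain rfl := hT.eq_of_par_eq_root hx hpx (ne_root_of_coeff (h i)) hi
      obtain ⟨R, hR, hRi⟩ := hsim' i
      have := hT.eq_of_v_le hx hpx (ne_root_of_coeff (h (i + 1))) (hR.le_v hRi)
      simpa [this] using h i
    · push Not at hex
      exact ih (fun i => T.par (w i)) (fun i => by rw [hw])
        (fun i => hf.coeff_par hT (h i) (hsim' i) (hex i)) hd

/-- Iterating a self-map of a finite set produces a periodic sequence. -/
theorem exists_periodic {α : Type*} [Finite α] [Nonempty α] (f : α → α) :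
    ∃ (k : ℕ) (w : ℕ → α), 0 < k ∧ (∀ i, w (i + k) = w i) ∧ ∀ i, w (i + 1) = f (w i) := by
  obtain ⟨a⟩ := ‹Nonempty α›
  obtain ⟨i, j, hne, hij⟩ := Finite.exists_ne_map_eq_of_infinite fun i => f^[i] a
  wlog hlt : i < j generalizing i j
  · exact this j i hne.symm hij.symm (lt_of_le_of_ne (not_lt.1 hlt) hne.symm)
  refine ⟨j - i, fun m => f^[m] (f^[i] a), by omega, fun m => ?_,
    fun m => Function.iterate_succ_apply' f m _⟩
  have hij : f^[i] a = f^[j] a := hij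
  change f^[m + (j - i)] (f^[i] a) = f^[m] (f^[i] a)
  rw [Function.iterate_add_apply, ← Function.iterate_add_apply f (j - i), Nat.sub_add_cancel hlt.le,
    ← hij]

/-- Let `k` be the least value in the support of `a = f a`. Each support element of value `k`
receives a nonzero coefficient from another such element, so finiteness produces a closed walk. -/
theorem Valuated.coeff_top_of_fixed [Fact p.Prime] (hn : 0 < n) (hT : T.Irretractable)
    {f : T.S p →+ T.S p} (hf : Valuated f) {x : T.carrier} (hx : x ≠ T.root)
    (hpx : T.par x = T.root) {a : T.S p} (ha : a ≠ 0) (hfa : f a = a) :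
    T.coeff p x (f (T.cls p x)) ≠ 0 := by
  obtain ⟨k, y, hy, hya, hak⟩ := exists_least_coeff hn ha
  have hpred : ∀ y : {y // T.v y = k ∧ T.coeff p y a ≠ 0},
      ∃ z : {y // T.v y = k ∧ T.coeff p y a ≠ 0}, T.coeff p y.1 (f (T.cls p z.1)) ≠ 0 := by
    rintro ⟨y, hy, hya⟩
    obtain ⟨z, hz, h1, h2⟩ := hf.exists_coeff hn hak hy (by rwa [hfa])
    exact ⟨⟨z, hz, h1⟩, h2⟩
  choose g hg using hpred
  have : Nonempty {y // T.v y = k ∧ T.coeff p y a ≠ 0} := ⟨⟨y, hy, hya⟩⟩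
  obtain ⟨m, w, hm, hw, hwg⟩ := exists_periodic g
  exact hf.coeff_top_of_cycle hT hx hpx hm n (fun i => (w i).1) (fun i => by rw [hw])
    (fun i => by rw [hwg]; exact hg _) (T.iterate_eq_root _)

/-- An endomorphism with nonzero coefficient at the top is injective. -/
theorem Valuated.injective_of_coeff_top [Fact p.Prime] (hn : 0 < n) (hT : T.Irretractable)
    {f : T.S p →+ T.S p} (hf : Valuated f) {x : T.carrier} (hx : x ≠ T.root)
    (hpx : T.par x = T.root) (h : T.coeff p x (f (T.cls p x)) ≠ 0) : Function.Injective f := by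
  have hp := (Fact.out : p.Prime)
  -- The top coefficient is killed by `p` because `par x` is the root. It is therefore `j • p ^ (n -
  -- 1)`, with `j` prime to `p`.
  obtain ⟨j, hj⟩ := exists_eq_mul_pow (c := T.coeff p x (f (T.cls p x))) hn (by
    rw [← map_nsmul, ← map_nsmul, nsmul_cls, hpx, cls_root, map_zero, map_zero])
  have hpj : ¬ (p : ℤ) ∣ j := fun hd => h (by rw [hj, zsmul_pow_eq_zero_iff hn]; exact hd)
  have hcop : IsCoprime (p : ℤ) j :=
    (Nat.prime_iff_prime_int.1 hp).irreducible.coprime_iff_not_dvd.2 hpj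
  obtain ⟨s, c, hsc⟩ := hcop
  rw [injective_iff_map_eq_zero]
  intro a ha
  by_contra hne
  -- With `s * p + c * j = 1`, the map `id - c • f` fixes the kernel element `a`, but its top
  -- coefficient is `(1 - c * j) • p ^ (n - 1) = 0`.
  refine (Valuated.id.sub (hf.zsmul c)).coeff_top_of_fixed hn hT hx hpx hne (by simp [ha]) ?_
  simp only [AddMonoidHom.sub_apply, AddMonoidHom.id_apply, AddMonoidHom.zsmul_apply, map_sub,
    map_zsmul]
  rw [coeff_self hx, hj, smul_smul]
  nth_rewrite 1 [← one_zsmul ((p : ZMod (p ^ n)) ^ (n - 1))]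
  rw [← sub_smul, zsmul_pow_eq_zero_iff hn]
  exact ⟨s, by linarith⟩

/-- An irretractable tree is determined by the valuated group `S(T)`, among irretractable
trees. -/
theorem nonempty_iso_of_valuated [Fact p.Prime] (hn : 0 < n) [Nontrivial T.carrier]
    (hT : T.Irretractable) (hT' : T'.Irretractable) {f : T.S p →+ T'.S p}
    {g : T'.S p →+ T.S p} (hf : Valuated f) (hg : Valuated g) (h : ∀ a, g (f a) = a) :
    Nonempty (T ≅ T') := by
  obtain ⟨x, hx, hpx⟩ := T.exists_par_eq_root
  obtain ⟨u, hpu, h1, h2⟩ := hf.coeff_top_of_leftInverse hn hT' hg h hx hpx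
  have zeroHom : ∀ U V : ValTree.{u} n, ∃ z : U ⟶ V, ∀ a, z.toFun a = V.root := fun U V =>
    ⟨⟨fun _ => V.root, fun _ => V.par_root.symm, fun _ => by rw [V.v_root]; exact le_top⟩,
      fun _ => rfl⟩
  obtain ⟨z, hz⟩ := zeroHom T T'
  obtain ⟨z', hz'⟩ := zeroHom T' T
  have hu := ne_root_of_coeff h1
  -- The zero morphism is modified below the tops; the resulting morphisms match the tops, so both
  -- composites are identities.
  obtain ⟨φ, hφ, -⟩ := hf.isSimulation.exists_hom hx h1 z (by rw [hz, hpu])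
  obtain ⟨ψ, hψ, -⟩ := hg.isSimulation.exists_hom hu h2 z' (by rw [hz', hpx])
  exact ⟨⟨φ, ψ, hT.eq_id hx (show ψ.toFun (φ.toFun x) = x by rw [hφ, hψ]),
    hT'.eq_id hu (show φ.toFun (ψ.toFun u) = u by rw [hψ, hφ])⟩⟩

end Endo

/-! ### The tree `Tᵢ` -/

theorem stageSet_mono (T : ValTree.{u} n) : Monotone T.stageSet :=
  monotone_nat_of_le_succ fun _ _ h => Or.inl h

theorem exists_of_inr_mem (T : ValTree.{u} n) {j : ℕ} {x : T.carrier} {m : ℕ}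
    (h : .inr (x, m) ∈ T.stageSet j) : ∃ i, T.v x = (i + 1 : ℕ) ∧ i + 1 ≤ j ∧
      T.heightIn (T.stageSet i) (.inl x) < (i + 1 : ℕ) ∧ m < i + 1 := by
  induction j with
  | zero => obtain ⟨y, hy⟩ := h; cases hy
  | succ j ih =>
    rcases h with h | ⟨y, k, hz, hv, hh, hk⟩
    · obtain ⟨i, h1, h2, h3⟩ := ih h
      exact ⟨i, h1, h2.trans (Nat.le_succ j), h3⟩
    · cases hz
      exact ⟨j, hv, le_rfl, hh, hk⟩

theorem le_heightIn (T : ValTree.{u} n) {A : Set T.Ext} {y z : T.Ext} {t : ℕ} (hy : y ∈ A)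
    (h : T.extPar^[t] y = z) : (t : ℕ∞) ≤ T.heightIn A z :=
  le_iSup₂_of_le (f := fun (t : ℕ) (_ : ∃ y ∈ A, T.extPar^[t] y = z) => (t : ℕ∞)) t ⟨y, hy, h⟩
    le_rfl

theorem exists_of_le_heightIn (T : ValTree.{u} n) {A : Set T.Ext} {z : T.Ext} {i : ℕ}
    (h : ((i + 1 : ℕ) : ℕ∞) ≤ T.heightIn A z) : ∃ t ≥ i + 1, ∃ y ∈ A, T.extPar^[t] y = z := by
  by_contra! hcon
  have : T.heightIn A z ≤ (i : ℕ∞) := by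
    refine iSup₂_le fun t ⟨y, hy, ht⟩ => ?_
    by_contra hlt
    exact hcon t (by exact_mod_cast not_le.1 hlt) y hy ht
  have h' : i + 1 ≤ i := by exact_mod_cast h.trans this
  omega

theorem extPar_iterate_inl (T : ValTree.{u} n) (t : ℕ) (x : T.carrier) :
    T.extPar^[t] (.inl x) = .inl (T.par^[t] x) := by
  induction t generalizing x with
  | zero => rfl
  | succ t ih => exact ih (T.par x)

theorem extPar_iterate_inr (T : ValTree.{u} n) {x : T.carrier} {m k : ℕ}
    (h : ((m + k : ℕ) : ℕ∞) < T.v x) : T.extPar^[k] (.inr (x, m)) = .inr (x, m + k) := by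
  induction k with
  | zero => rfl
  | succ k ih =>
    rw [Function.iterate_succ_apply', ih (lt_of_le_of_lt (by exact_mod_cast Nat.le_succ _) h)]
    exact if_pos h

theorem extPar_iterate_inr_eq_inl (T : ValTree.{u} n) {x : T.carrier} {m k i : ℕ}
    (hv : T.v x = i) (hm : m < i) (h : m + k = i) : T.extPar^[k] (.inr (x, m)) = .inl x := by
  obtain ⟨k, rfl⟩ : ∃ l, k = l + 1 := ⟨k - 1, by omega⟩
  rw [Function.iterate_succ_apply', T.extPar_iterate_inr (by rw [hv]; exact_mod_cast (by omega))]
  refine if_neg ?_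
  rw [hv, ← h]
  exact lt_irrefl _

theorem eq_inr_of_iterate (T : ValTree.{u} n) {z : T.Ext} {y : T.carrier} {m t : ℕ}
    (h : T.extPar^[t] z = .inr (y, m)) : ∃ k, z = .inr (y, k) ∧ m = k + t := by
  induction t generalizing m with
  | zero => exact ⟨m, h, rfl⟩
  | succ t ih =>
    rw [Function.iterate_succ_apply'] at h
    rcases hz : T.extPar^[t] z with x | ⟨x, k⟩
    · rw [hz] at h; cases h
    · rw [hz] at h
      simp only [extPar] at h
      split_ifs at h
      cases h
      obtain ⟨l, h1, h2⟩ := ih hz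
      exact ⟨l, h1, by omega⟩

variable (T : ValTree.{u} n)

/-- The element of the ambient set underlying an element of `Tᵢ`. -/
def toExt {i : ℕ} (z : (T.stage i).carrier) : T.Ext := Subtype.val z

/-- The element of `Tᵢ` with given underlying element of the ambient set. -/
def ofExt {i : ℕ} (z : T.Ext) (hz : z ∈ T.stageSet i) : (T.stage i).carrier := Subtype.mk z hz

/-- The element of `Tᵢ` given by an element of `T`. -/
def inlExt (i : ℕ) (x : T.carrier) : (T.stage i).carrier := T.ofExt (.inl x) (T.inl_mem_stageSet i x)

theorem toExt_ofExt {i : ℕ} {z : T.Ext} (hz : z ∈ T.stageSet i) : T.toExt (T.ofExt z hz) = z := rfl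

theorem toExt_inlExt (i : ℕ) (x : T.carrier) : T.toExt (T.inlExt i x) = .inl x := rfl

theorem toExt_injective {i : ℕ} : Function.Injective (T.toExt (i := i)) := Subtype.val_injective

theorem exists_ofExt {i : ℕ} (z : (T.stage i).carrier) : ∃ x hx, z = T.ofExt x hx :=
  ⟨T.toExt z, Subtype.property z, rfl⟩

theorem v_ofExt {i : ℕ} {z : T.Ext} (hz : z ∈ T.stageSet i) :
    (T.stage i).v (T.ofExt z hz) = T.extV z := rfl

theorem inlExt_root (i : ℕ) : T.inlExt i T.root = (T.stage i).root := rfl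

theorem inlExt_ne_root {i : ℕ} {x : T.carrier} (hx : x ≠ T.root) :
    T.inlExt i x ≠ (T.stage i).root :=
  fun h => hx (Sum.inl_injective (congrArg T.toExt h))

theorem inr_ne_root {i : ℕ} {x : T.carrier} {m : ℕ} (h : .inr (x, m) ∈ T.stageSet i) :
    T.ofExt _ h ≠ (T.stage i).root :=
  fun h => nomatch congrArg T.toExt h

theorem toExt_iterate {j : ℕ} (t : ℕ) (z : (T.stage j).carrier) :
    T.toExt ((T.stage j).par^[t] z) = T.extPar^[t] (T.toExt z) := by
  induction t generalizing z with
  | zero => rfl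
  | succ t ih => exact ih ((T.stage j).par z)

/-- In `Tₙ₋₁` the value of an element is its height. -/
theorem stage_exists_iterate (z : (T.stage (n - 1)).carrier) {k : ℕ}
    (h : (k : ℕ∞) ≤ (T.stage (n - 1)).v z) : ∃ w, (T.stage (n - 1)).par^[k] w = z := by
  obtain ⟨x | ⟨x, m⟩, hz, rfl⟩ := T.exists_ofExt z
  · by_cases hx : x = T.root
    · subst hx
      exact ⟨_, (T.stage (n - 1)).iterate_root k⟩
    obtain ⟨i, hi, hin⟩ := T.exists_v_eq hx
    replace h : (k : ℕ∞) ≤ T.v x := h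
    rw [hi] at h
    replace h : k ≤ i := by exact_mod_cast h
    -- An element `t ≥ k` steps below is enough: its `(t - k)`-th parent is `k` steps below.
    suffices ∃ t ≥ i, ∃ y ∈ T.stageSet (n - 1), T.extPar^[t] y = .inl x by
      obtain ⟨t, hti, y, hy, ht⟩ := this
      refine ⟨(T.stage (n - 1)).par^[t - k] (T.ofExt y hy), T.toExt_injective ?_⟩
      rw [par_iterate_add, toExt_iterate, show k + (t - k) = t by omega]
      exact ht
    rcases i with _ | i
    · exact ⟨0, le_rfl, .inl x, hz, rfl⟩
    -- Either step `i + 1` attaches a tail of length `i + 1` at `x`, or stage `i` already contains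
    -- an element that far below `x`.
    by_cases hh : T.heightIn (T.stageSet i) (.inl x) < (i + 1 : ℕ)
    · refine ⟨i + 1, le_rfl, .inr (x, 0), T.stageSet_mono (show i + 1 ≤ n - 1 by omega)
        (Or.inr ⟨x, 0, rfl, hi, hh, by omega⟩), T.extPar_iterate_inr_eq_inl hi (by omega) (by omega)⟩
    · obtain ⟨t, ht, y, hy, e⟩ := T.exists_of_le_heightIn (not_lt.1 hh)
      exact ⟨t, ht, y, T.stageSet_mono (show i ≤ n - 1 by omega) hy, e⟩
  · replace h : (k : ℕ∞) ≤ (m : ℕ∞) := h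
    replace h : k ≤ m := by exact_mod_cast h
    have hm := (T.lt_v_of_inr_mem hz).1
    refine ⟨T.ofExt (.inr (x, m - k)) (T.inr_succ_mem hz
      (lt_of_le_of_lt (by exact_mod_cast Nat.sub_le m k) hm)), T.toExt_injective ?_⟩
    rw [toExt_iterate, toExt_ofExt, toExt_ofExt]
    have : m - k + k = m := by omega
    rw [T.extPar_iterate_inr (by rwa [this]), this]

/-- If `(x, m)` was added to `T`, then `(x, 0)` is the only element far below `x`. -/
theorem stage_iterate_eq_inl_iff {x : T.carrier} {m i : ℕ}
    (hx : .inr (x, m) ∈ T.stageSet (n - 1)) (hi : T.v x = i) (w : (T.stage (n - 1)).carrier) :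
    T.toExt ((T.stage (n - 1)).par^[i] w) = .inl x ↔ T.toExt w = .inr (x, 0) := by
  obtain ⟨j, hj, hjn, hh, hm⟩ := T.exists_of_inr_mem hx
  obtain rfl : i = j + 1 := by rw [hj] at hi; exact_mod_cast hi.symm
  have hxr : x ≠ T.root := by
    rintro rfl
    rw [T.v_root] at hj
    exact absurd hj (ENat.top_ne_natCast _)
  rw [toExt_iterate]
  constructor
  · intro h
    obtain ⟨z | ⟨z, k⟩, hw, rfl⟩ := T.exists_ofExt w
    · exact absurd (T.le_heightIn (T.inl_mem_stageSet j z) h) (not_le.2 hh)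
    · obtain ⟨l, hl, -, -, hk⟩ := T.exists_of_inr_mem hw
      have hkl : T.extPar^[l + 1 - k] (.inr (z, k)) = .inl z :=
        T.extPar_iterate_inr_eq_inl hl hk (by omega)
      replace h : T.extPar^[j + 1] (.inr (z, k)) = .inl x := h
      have hle : l + 1 - k ≤ j + 1 := by
        by_contra hlt
        rw [T.extPar_iterate_inr (by rw [hl]; exact_mod_cast (by omega))] at h
        cases h
      obtain ⟨d, hd⟩ := Nat.exists_eq_add_of_le' hle
      rw [hd, Function.iterate_add_apply, hkl, extPar_iterate_inl, Sum.inl.injEq] at h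
      rcases d with _ | d
      · obtain rfl : z = x := h
        have : l = j := by rw [hl] at hi; norm_cast at hi; omega
        change Sum.inr (z, k) = _
        rw [show k = 0 by omega]
      -- Here `z` lies strictly below `x`, so its smaller value puts the tail element `(z, k)` into
      -- stage `j` already. There it gives `x` height at least `j + 1`, a contradiction.
      · exfalso
        have hlt := T.v_lt_iterate (T.ne_root_of_iterate h hxr) (Nat.succ_ne_zero d)
        rw [h, hl, hj] at hlt
        have hlj : l + 1 ≤ j := by
          have : l + 1 < j + 1 := by exact_mod_cast hlt
          omega
        have hmem : .inr (z, k) ∈ T.stageSet j := by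
          obtain ⟨l', hl', hl'n, hh', hk'⟩ := T.exists_of_inr_mem hw
          obtain rfl : l' = l := by rw [hl'] at hl; norm_cast at hl; omega
          exact T.stageSet_mono hlj (Or.inr ⟨z, k, rfl, hl', hh', hk'⟩)
        refine absurd (T.le_heightIn hmem (t := j + 1) (z := .inl x) ?_) (not_le.2 hh)
        rw [hd, Function.iterate_add_apply, hkl, extPar_iterate_inl, h]
  · intro h
    rw [h]
    exact T.extPar_iterate_inr_eq_inl hj (by omega) (by omega)

theorem stage_iterate_eq_inr_iff {x : T.carrier} {m : ℕ}
    (hx : .inr (x, m) ∈ T.stageSet (n - 1)) (w : (T.stage (n - 1)).carrier) :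
    T.toExt ((T.stage (n - 1)).par^[m] w) = .inr (x, m) ↔ T.toExt w = .inr (x, 0) := by
  rw [toExt_iterate]
  constructor
  · intro h
    obtain ⟨k, hk, hm⟩ := T.eq_inr_of_iterate h
    rw [hk, show k = 0 by omega]
  · intro h
    have := (T.lt_v_of_inr_mem hx).1
    rw [h, T.extPar_iterate_inr (by simpa using this), zero_add]

/-! ### The group `S(Tₙ₋₁)` -/

section Stage

variable (p : ℕ)

/-- The inclusion `S(γ) : S(T) → S(Tₙ₋₁)`. -/
def toStage : T.S p →+ (T.stage (n - 1)).S p := (mapS p (T.incl (n - 1))).toAddMonoidHom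

variable {T p}

theorem toStage_cls (x : T.carrier) :
    T.toStage p (T.cls p x) = (T.stage (n - 1)).cls p (T.inlExt _ x) :=
  mapS_cls p (T.incl (n - 1)) x

/-- The elements of `T` are closed under `par` in `Tₙ₋₁`, so the added elements do not affect these
coefficients. -/
theorem coeff_toStage (y : T.carrier) (a : T.S p) :
    (T.stage (n - 1)).coeff p (T.inlExt _ y) (T.toStage p a) =
      T.coeff p y a := by
  by_cases hy : y = T.root
  · subst hy
    rw [inlExt_root, coeff_root, coeff_root, AddMonoidHom.zero_apply, AddMonoidHom.zero_apply]
  have : ((T.stage (n - 1)).coeff p (T.inlExt _ y)).comp (T.toStage p) =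
      T.coeff p y := by
    classical
    refine addHom_ext fun x => ?_
    rw [AddMonoidHom.comp_apply, toStage_cls, coeff_cls _ _ _ _ (T.inlExt_ne_root hy),
      coeff_cls _ _ _ _ hy]
    refine Finset.sum_congr rfl fun t _ => if_congr ?_ rfl rfl
    rw [← T.toExt_injective.eq_iff, toExt_iterate, toExt_inlExt, toExt_inlExt,
      extPar_iterate_inl, Sum.inl.injEq]
  exact DFunLike.congr_fun this a

/-- Only `(y, 0)` lies `m` steps below `(y, m)`, and only `(y, 0)` lies `v y` steps below `y`. Both
sides therefore count the occurrences of `(y, 0)` among the iterated parents. -/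
theorem coeff_inr {y : T.carrier} {m i : ℕ} (hy : .inr (y, m) ∈ T.stageSet (n - 1))
    (hi : T.v y = i) (b : (T.stage (n - 1)).S p) :
    (T.stage (n - 1)).coeff p (T.ofExt (.inr (y, m)) hy) (p ^ m • b) =
      (T.stage (n - 1)).coeff p (T.inlExt _ y) (p ^ i • b) := by
  classical
  have hyr : y ≠ T.root := by rintro rfl; simp [T.v_root] at hi
  have : ((T.stage (n - 1)).coeff p (T.ofExt (.inr (y, m)) hy)).comp (nsmulAddMonoidHom (p ^ m)) =
      ((T.stage (n - 1)).coeff p (T.inlExt _ y)).comp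
        (nsmulAddMonoidHom (p ^ i)) := by
    refine addHom_ext fun z => ?_
    simp only [AddMonoidHom.comp_apply, nsmulAddMonoidHom_apply, pow_nsmul_cls]
    rw [coeff_cls _ _ _ _ (T.inlExt_ne_root hyr), coeff_cls _ _ _ _
      (T.inr_ne_root hy)]
    refine Finset.sum_congr rfl fun t _ => if_congr ?_ rfl rfl
    rw [par_iterate_add, par_iterate_add, add_comm t m, add_comm t i, ← par_iterate_add,
      ← par_iterate_add, ← T.toExt_injective.eq_iff, ← T.toExt_injective.eq_iff, toExt_ofExt,
      toExt_inlExt, T.stage_iterate_eq_inr_iff hy,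
      T.stage_iterate_eq_inl_iff hy hi]
  exact DFunLike.congr_fun this b

theorem mem_filt_stage_iff {k : ℕ} {b : (T.stage (n - 1)).S p} :
    b ∈ (T.stage (n - 1)).filt p k ↔ ∃ c, b = p ^ k • c := by
  constructor
  · have : (T.stage (n - 1)).filt p k ≤
        (nsmulAddMonoidHom (α := (T.stage (n - 1)).S p) (p ^ k)).range := filt_le fun z hz => by
      obtain ⟨w, rfl⟩ := T.stage_exists_iterate z hz
      exact ⟨(T.stage (n - 1)).cls p w, pow_nsmul_cls _ _ _ _⟩
    intro h
    obtain ⟨c, hc⟩ := this h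
    exact ⟨c, hc.symm⟩
  · rintro ⟨c, rfl⟩
    induction c using S_induction with
    | h0 => simp
    | hadd a b ha hb => rw [smul_add]; exact add_mem ha hb
    | hcls j x =>
      rw [smul_comm, pow_nsmul_cls]
      exact zsmul_mem (cls_mem_filt (le_v_iterate _ _ _)) _

/-- The valuation of `S(T)` is encoded in the embedding alone. Elements of large value become
divisible in `S(Tₙ₋₁)`; conversely, the coefficients detect the filtration and are preserved by the
embedding. -/
theorem mem_filt_iff [Fact p.Prime] (hn : 0 < n) {k : ℕ} {a : T.S p} :
    a ∈ T.filt p k ↔ ∃ c, T.toStage p a = p ^ k • c := by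
  rw [← mem_filt_stage_iff]
  constructor
  · intro h
    have : T.filt p k ≤ ((T.stage (n - 1)).filt p k).comap (T.toStage p) := filt_le fun x hx => by
      rw [AddSubgroup.mem_comap, toStage_cls]
      exact cls_mem_filt hx
    exact this h
  · refine fun h => mem_filt_of_coeff hn fun y hy => ?_
    rw [← coeff_toStage]
    exact coeff_eq_zero_of_mem_filt h hy

variable {T' T'' : ValTree.{u} n}

theorem valuated_stage (f : (T.stage (n - 1)).S p →+ (T'.stage (n - 1)).S p) : Valuated f := by
  intro k a ha
  rw [mem_filt_stage_iff] at ha ⊢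
  obtain ⟨c, rfl⟩ := ha
  exact ⟨f c, map_nsmul _ _ _⟩

/-- A valuated homomorphism `S(T) → S(T')` extends to `S(Tₙ₋₁) → S(T'ₙ₋₁)`. -/
theorem Valuated.exists_extension [Fact p.Prime] (hn : 0 < n) {f : T.S p →+ T'.S p}
    (hf : Valuated f) : ∃ F : (T.stage (n - 1)).S p →+ (T'.stage (n - 1)).S p,
      F.comp (T.toStage p) = (T'.toStage p).comp f := by
  -- Since `f [x]` has value at least `v x`, it becomes divisible by `p ^ v x` upstairs. At the
  -- root, of infinite value, the condition is void.
  have hb : ∀ x, ∃ b, ∀ i : ℕ, T.v x = i → T'.toStage p (f (T.cls p x)) = p ^ i • b := by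
    intro x
    by_cases hx : x = T.root
    · refine ⟨0, fun i hi => ?_⟩
      rw [hx, v_root] at hi
      simp at hi
    obtain ⟨i, hi, -⟩ := T.exists_v_eq hx
    obtain ⟨b, hb⟩ := (mem_filt_iff hn).1 (hf i _ (cls_mem_filt hi.ge))
    refine ⟨b, fun j hj => ?_⟩
    rw [hi] at hj
    have : i = j := by exact_mod_cast hj
    rw [← this, hb]
  choose b hb using hb
  -- A tail element `(x, m)` goes to `p ^ m • b x`; the end of the tail fits because `p ^ v x • b x`
  -- is the image of `f [x]`.
  let φ : (T.stage (n - 1)).carrier → (T'.stage (n - 1)).S p := fun z =>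
    Sum.elim (fun x => T'.toStage p (f (T.cls p x))) (fun q => p ^ q.2 • b q.1) (T.toExt z)
  have hroot : φ (T.stage (n - 1)).root = 0 := by
    have : T'.toStage p (f (T.cls p T.root)) = 0 := by rw [cls_root, map_zero, map_zero]
    exact this
  have hpar : ∀ z, p • φ z = φ ((T.stage (n - 1)).par z) := by
    intro z
    obtain ⟨x | ⟨x, m⟩, hz, rfl⟩ := T.exists_ofExt z
    · change p • T'.toStage p (f (T.cls p x)) = T'.toStage p (f (T.cls p (T.par x)))
      rw [← nsmul_cls, map_nsmul, map_nsmul]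
    · obtain ⟨i, hi, -, -, hm⟩ := T.exists_of_inr_mem hz
      change p • p ^ m • b x = Sum.elim (fun x => T'.toStage p (f (T.cls p x)))
        (fun q => p ^ q.2 • b q.1) (T.extPar (.inr (x, m)))
      rw [smul_smul, ← pow_succ', extPar]
      split_ifs with h
      · rfl
      · rw [hi, Nat.cast_lt] at h
        rw [Sum.elim_inl, hb x _ hi, show m + 1 = i + 1 by omega]
  refine ⟨(T.stage (n - 1)).lift p φ hroot hpar, addHom_ext fun x => ?_⟩
  rw [AddMonoidHom.comp_apply, toStage_cls, lift_cls]
  rfl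

/-- An endomorphism of `S(Tₙ₋₁)` that is the identity on `S(T)` is injective. -/
theorem injective_of_comp_toStage [Fact p.Prime] (hn : 0 < n)
    {F : (T.stage (n - 1)).S p →+ (T.stage (n - 1)).S p}
    (hF : ∀ a, F (T.toStage p a) = T.toStage p a) : Function.Injective F := by
  rw [injective_iff_map_eq_zero]
  intro c hc
  by_contra hc0
  obtain ⟨k, y, hy, hyc, hk⟩ := exists_least_coeff hn hc0
  -- `G = id - F` kills `S(T)` and fixes the kernel element `c`. In the support of `c` at its least
  -- value `k`, predecessors under `G` are thus tail elements `(x, k)`.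
  let G : (T.stage (n - 1)).S p →+ (T.stage (n - 1)).S p := AddMonoidHom.id _ - F
  have hG : ∀ a, G (T.toStage p a) = 0 := fun a => by
    simp only [G, AddMonoidHom.sub_apply, AddMonoidHom.id_apply, hF, sub_self]
  have hGc : G c = c := by
    simp only [G, AddMonoidHom.sub_apply, AddMonoidHom.id_apply, hc, sub_zero]
  have hpred : ∀ z : (T.stage (n - 1)).carrier, (T.stage (n - 1)).v z = k →
      (T.stage (n - 1)).coeff p z c ≠ 0 → ∃ (x : T.carrier)
        (hx : .inr (x, k) ∈ T.stageSet (n - 1)),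
        (T.stage (n - 1)).coeff p (T.ofExt (.inr (x, k)) hx) c ≠ 0 ∧
        (T.stage (n - 1)).coeff p z (G ((T.stage (n - 1)).cls p (T.ofExt (.inr (x, k)) hx))) ≠ 0 := by
    intro z hz hzc
    obtain ⟨w, h1, h2, h3⟩ := (valuated_stage G).exists_coeff hn hk hz (by rwa [hGc])
    obtain ⟨x | ⟨x, m⟩, hx, rfl⟩ := T.exists_ofExt w
    · rw [show T.ofExt (.inl x) hx = T.inlExt _ x from rfl, ← toStage_cls, hG, map_zero] at h3
      exact absurd rfl h3
    · obtain rfl : m = k := by rw [v_ofExt, extV] at h1; exact_mod_cast h1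
      exact ⟨x, hx, h2, h3⟩
  -- Passing from `(y, k)` to a predecessor `(x, k)` strictly raises the value of the base point,
  -- while values stay below `n`. Iterating bounds `v y + d` by `n` for every `d`, which is absurd.
  have hasc : ∀ (d : ℕ) (y : T.carrier) (hy : .inr (y, k) ∈ T.stageSet (n - 1)),
      (T.stage (n - 1)).coeff p (T.ofExt (.inr (y, k)) hy) c ≠ 0 →
        ∀ j : ℕ, T.v y = j → j + d ≤ n := by
    intro d
    induction d with
    | zero =>
      intro y hy _ j hj
      have := (T.lt_v_of_inr_mem hy).2
      rw [hj] at this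
      have : j ≤ n - 1 := by exact_mod_cast this
      omega
    | succ d ih =>
      intro y hy hyc j hj
      obtain ⟨x, hx, h1, h2⟩ := hpred _ (T.v_ofExt hy) hyc
      obtain ⟨i, hi, -, -, hki⟩ := T.exists_of_inr_mem hx
      have hx0 : .inr (x, 0) ∈ T.stageSet (n - 1) :=
        T.inr_succ_mem hx (by rw [hi]; exact_mod_cast Nat.succ_pos i)
      have hpar : ∀ t, (T.stage (n - 1)).par^[i + 1 + t] (T.ofExt _ hx0) =
          T.inlExt _ (T.par^[t] x) := fun t => T.toExt_injective (by
        rw [toExt_iterate, toExt_ofExt, toExt_inlExt, add_comm, Function.iterate_add_apply,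
          T.extPar_iterate_inr_eq_inl hi (by omega) (by omega), extPar_iterate_inl])
      have hxk : T.ofExt _ hx = (T.stage (n - 1)).par^[k] (T.ofExt _ hx0) :=
        T.toExt_injective (by
          rw [toExt_iterate, toExt_ofExt, toExt_ofExt, T.extPar_iterate_inr, zero_add]
          rw [hi]; exact_mod_cast (by omega))
      rw [hxk, ← pow_nsmul_cls, map_nsmul, coeff_inr hy hj, ← map_nsmul, pow_nsmul_cls] at h2
      -- Otherwise the `j`-th parent of `(x, 0)` lies in `T`, where `G` vanishes.
      have hlt : j < i + 1 := by
        by_contra hle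
        obtain ⟨t, rfl⟩ := Nat.exists_eq_add_of_le (not_lt.1 hle)
        rw [hpar, ← toStage_cls, hG, map_zero] at h2
        exact h2 rfl
      have := ih x hx h1 (i + 1) hi
      omega
  obtain ⟨x, hx, h1, -⟩ := hpred y hy hyc
  obtain ⟨i, hi, -⟩ := T.exists_of_inr_mem hx
  have := hasc (n + 1) x hx h1 (i + 1) hi
  omega

end Stage

end ValTree

/-! ### Uniqueness of decompositions in preadditive categories -/

section KrullSchmidt

universe v₁ u₁

variable {C : Type u₁} [Category.{v₁} C]

theorem isIso_of_isIso_comp_comp {X Y : C} (f : X ⟶ Y) (g : Y ⟶ X) [IsIso (f ≫ g)]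
    [IsIso (g ≫ f)] : IsIso f := by
  have : Mono f := mono_of_mono f g
  have : IsSplitEpi f := IsSplitEpi.mk' ⟨inv (g ≫ f) ≫ g, by simp [Category.assoc]⟩
  exact isIso_of_mono_of_isSplitEpi f

variable [Preadditive C]

/-- An object with an additive function on its endomorphisms that is nonzero at the identity and
vanishes at all endomorphisms that are not isomorphisms; its endomorphism ring is local. -/
def HasLocalFunctional (X : C) : Prop :=
  ∃ (A : Type) (_ : AddCommGroup A) (l : (X ⟶ X) →+ A), l (𝟙 X) ≠ 0 ∧ ∀ f, l f ≠ 0 → IsIso f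

theorem HasLocalFunctional.not_isZero {X : C} (h : HasLocalFunctional X) : ¬ IsZero X := by
  obtain ⟨A, _, l, h1, -⟩ := h
  intro hX
  rw [IsZero.iff_id_eq_zero] at hX
  rw [hX, map_zero] at h1
  exact h1 rfl

/-- A split monomorphism from a nonzero object to an object with local endomorphism ring is an
isomorphism. -/
theorem HasLocalFunctional.isIso_of_comp {X Y : C} (hX : ¬ IsZero X) (hY : HasLocalFunctional Y)
    (f : X ⟶ Y) (g : Y ⟶ X) [IsIso (f ≫ g)] : IsIso f := by
  obtain ⟨A, _, l, h1, hl⟩ := hY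
  have hfe : f ≫ (g ≫ inv (f ≫ g) ≫ f) = f := by
    rw [← Category.assoc, ← Category.assoc, IsIso.hom_inv_id, Category.id_comp]
  -- The functional is nonzero on this idempotent or on its complement. If the complement is
  -- invertible, then `f`, which it annihilates, is zero.
  by_cases he : l (g ≫ inv (f ≫ g) ≫ f) = 0
  · exfalso
    have : IsIso (𝟙 Y - g ≫ inv (f ≫ g) ≫ f) := hl _ (by rwa [map_sub, he, sub_zero])
    have h0 : f ≫ (𝟙 Y - g ≫ inv (f ≫ g) ≫ f) = 0 := by
      rw [Preadditive.comp_sub, hfe, Category.comp_id, sub_self]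
    have hf : f = 0 := by
      rw [← cancel_mono (𝟙 Y - g ≫ inv (f ≫ g) ≫ f), h0, zero_comp]
    apply hX
    rw [IsZero.iff_id_eq_zero, ← cancel_mono (f ≫ g), zero_comp, Category.id_comp, hf, zero_comp]
  · have := hl _ he
    have : Mono f := mono_of_mono f g
    have : IsSplitEpi f := IsSplitEpi.mk' ⟨inv (g ≫ inv (f ≫ g) ≫ f) ≫ g ≫ inv (f ≫ g), by
      simp only [Category.assoc]
      exact IsIso.inv_hom_id (g ≫ inv (f ≫ g) ≫ f)⟩
    exact isIso_of_mono_of_isSplitEpi f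

variable [HasFiniteBiproducts C] [HasBinaryBiproducts C]

/-- Splitting off one summand of a direct sum. -/
def biproductSuccAboveIso {m : ℕ} (F : Fin (m + 1) → C) (j : Fin (m + 1)) :
    (F j ⊞ ⨁ fun k => F (j.succAbove k)) ≅ ⨁ F where
  hom := biprod.desc (biproduct.ι F j) (biproduct.desc fun k => biproduct.ι F (j.succAbove k))
  inv := biprod.lift (biproduct.π F j) (biproduct.lift fun k => biproduct.π F (j.succAbove k))
  hom_inv_id := by
    refine biprod.hom_ext' _ _ ?_ ?_
    · refine biprod.hom_ext _ _ (by simp) ?_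
      refine biproduct.hom_ext _ _ fun k => ?_
      simp [biproduct.ι_π_ne _ (Fin.succAbove_ne j k).symm]
    · refine biproduct.hom_ext' _ _ fun i => ?_
      refine biprod.hom_ext _ _ ?_ ?_
      · simp [biproduct.ι_π_ne _ (Fin.succAbove_ne j i)]
      · refine biproduct.hom_ext _ _ fun k => ?_
        by_cases h : i = k
        · subst h; simp
        · simp [biproduct.ι_π_ne _ h,
            biproduct.ι_π_ne F (fun h' => h (Fin.succAbove_right_injective h'))]
  inv_hom_id := by
    rw [biprod.lift_desc, biproduct.lift_desc, ← biproduct.total, Fin.sum_univ_succAbove _ j]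

/-- The identity of `F' 0` is a sum of endomorphisms factoring through the `F j`, and the functional
is nonzero on one of them. That `F j` is isomorphic to `F' 0`, and Gaussian elimination cancels the
pair. -/
theorem exists_equiv_of_iso {m m' : ℕ} (F : Fin m → C) (F' : Fin m' → C)
    (hF : ∀ i, HasLocalFunctional (F i)) (hF' : ∀ i, HasLocalFunctional (F' i))
    (φ : ⨁ F' ≅ ⨁ F) : ∃ e : Fin m' ≃ Fin m, ∀ j, Nonempty (F' j ≅ F (e j)) := by
  induction m' generalizing m with
  | zero =>
    rcases m with _ | m
    · exact ⟨Equiv.refl _, fun j => j.elim0⟩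
    · exfalso
      apply (hF 0).not_isZero
      rw [IsZero.iff_id_eq_zero, ← biproduct.ι_π_self F 0]
      have : 𝟙 (⨁ F) = 0 := by
        rw [← φ.inv_hom_id, ← Category.id_comp φ.hom, ← biproduct.total]
        simp
      rw [← Category.id_comp (biproduct.π F 0), this]
      simp
  | succ m' ih =>
    have hsum : ∑ j, (biproduct.ι F' 0 ≫ φ.hom ≫ biproduct.π F j) ≫
        (biproduct.ι F j ≫ φ.inv ≫ biproduct.π F' 0) = 𝟙 (F' 0) := by
      have h : ∑ j, (biproduct.ι F' 0 ≫ φ.hom ≫ biproduct.π F j) ≫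
          (biproduct.ι F j ≫ φ.inv ≫ biproduct.π F' 0) = biproduct.ι F' 0 ≫ φ.hom ≫
            (∑ j, biproduct.π F j ≫ biproduct.ι F j) ≫ φ.inv ≫ biproduct.π F' 0 := by
        simp only [Preadditive.comp_sum, Preadditive.sum_comp, Category.assoc]
      rw [h, biproduct.total]
      simp
    obtain ⟨j, hj⟩ : ∃ j, IsIso ((biproduct.ι F' 0 ≫ φ.hom ≫ biproduct.π F j) ≫
        (biproduct.ι F j ≫ φ.inv ≫ biproduct.π F' 0)) := by
      obtain ⟨A, _, l, h1, hl⟩ := hF' 0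
      rw [← hsum, map_sum] at h1
      obtain ⟨j, -, hj⟩ := Finset.exists_ne_zero_of_sum_ne_zero h1
      exact ⟨j, hl _ hj⟩
    rcases m with _ | m
    · exact j.elim0
    have hα : IsIso (biproduct.ι F' 0 ≫ φ.hom ≫ biproduct.π F j) :=
      (hF j).isIso_of_comp (hF' 0).not_isZero _
        (biproduct.ι F j ≫ φ.inv ≫ biproduct.π F' 0)
    let ψ := biproductSuccAboveIso F' 0 ≪≫ φ ≪≫ (biproductSuccAboveIso F j).symm
    have hψ : biprod.inl ≫ ψ.hom ≫ biprod.fst = biproduct.ι F' 0 ≫ φ.hom ≫ biproduct.π F j := by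
      simp only [ψ, biproductSuccAboveIso, Iso.trans_hom, Iso.symm_hom, Category.assoc,
        biprod.lift_fst, biprod.inl_desc_assoc]
    have : IsIso (biprod.inl ≫ ψ.hom ≫ biprod.fst) := by rw [hψ]; exact hα
    obtain ⟨e, he⟩ := ih _ _ (fun k => hF (j.succAbove k)) (fun k => hF' (Fin.succAbove 0 k))
      (Biprod.isoElim ψ)
    refine ⟨(finSuccEquiv' 0).trans ((Equiv.optionCongr e).trans (finSuccEquiv' j).symm),
      fun i => ?_⟩
    rcases Fin.eq_self_or_eq_succAbove 0 i with rfl | ⟨k, rfl⟩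
    · simpa using ⟨asIso (biproduct.ι F' 0 ≫ φ.hom ≫ biproduct.π F j)⟩
    · rw [Equiv.trans_apply, Equiv.trans_apply, finSuccEquiv'_succAbove, Equiv.optionCongr_apply,
        Option.map_some, finSuccEquiv'_symm_some]
      exact he k

end KrullSchmidt

namespace SubRep

/-! ### Morphisms of representations with given component on the submodules -/

variable {R : Type w} [Ring R] {X Y Z : SubRep.{u} R}

/-- The component `M₁ → N₁` of a morphism, as an additive function of the morphism. -/
def fstHom (X Y : SubRep.{u} R) : (X ⟶ Y) →+ (X.M₁ →ₗ[R] Y.M₁) where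
  toFun g := g.φ₁
  map_zero' := rfl
  map_add' _ _ := rfl

theorem fstHom_comp (g : X ⟶ Y) (h : Y ⟶ Z) :
    fstHom X Z (g ≫ h) = fstHom Y Z h ∘ₗ fstHom X Y g := rfl

theorem fstHom_id : fstHom X X (𝟙 X) = LinearMap.id := rfl

theorem isIso_of_bijective (g : X ⟶ Y) (h₁ : Function.Bijective g.φ₁)
    (h₂ : Function.Bijective g.φ₂) : IsIso g := by
  let e₁ := LinearEquiv.ofBijective g.φ₁ h₁
  let e₂ := LinearEquiv.ofBijective g.φ₂ h₂
  refine ⟨⟨⟨e₁.symm, e₂.symm, LinearMap.ext fun y => ?_⟩, ?_, ?_⟩⟩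
  · obtain ⟨x, rfl⟩ := h₁.2 y
    have hx : e₁.symm (g.φ₁ x) = x := e₁.symm_apply_apply x
    have hc : Y.f (g.φ₁ x) = g.φ₂ (X.f x) := (LinearMap.congr_fun g.comm x).symm
    change e₂.symm (Y.f (g.φ₁ x)) = X.f (e₁.symm (g.φ₁ x))
    rw [hx, hc]
    exact e₂.symm_apply_apply _
  · exact hom_ext (LinearMap.ext e₁.symm_apply_apply) (LinearMap.ext e₂.symm_apply_apply)
  · exact hom_ext (LinearMap.ext e₁.apply_symm_apply) (LinearMap.ext e₂.apply_symm_apply)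

/-- Endomorphisms that are the identity on the submodule are isomorphisms. -/
def IsMinimal (X : SubRep.{u} R) : Prop :=
  ∀ θ : X ⟶ X, fstHom X X θ = LinearMap.id → IsIso θ

theorem fstHom_comp_comp {θ : Y ⟶ Y} (hθ : fstHom Y Y θ = LinearMap.id) (f : X ⟶ Y)
    (g : Y ⟶ Z) : fstHom X Z (f ≫ θ ≫ g) = fstHom X Z (f ≫ g) := by
  rw [fstHom_comp, fstHom_comp, hθ, fstHom_comp, LinearMap.comp_id]

/-- Write `θ` as a block matrix. On submodules the diagonal blocks are identities and the others
vanish, so `a` and then the Schur complement `d - c ≫ inv a ≫ b` are isomorphisms by minimality. -/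
theorem IsMinimal.biprod (hX : X.IsMinimal) (hY : Y.IsMinimal) : (X ⊞ Y).IsMinimal := by
  intro θ hθ
  have ha : IsIso (biprod.inl ≫ θ ≫ biprod.fst) := hX _ (by
    rw [fstHom_comp_comp hθ, biprod.inl_fst, fstHom_id])
  let a := biprod.inl ≫ θ ≫ biprod.fst
  let b := biprod.inl ≫ θ ≫ biprod.snd
  let c := biprod.inr ≫ θ ≫ biprod.fst
  let d := biprod.inr ≫ θ ≫ biprod.snd
  have hb : fstHom _ _ b = 0 := by
    rw [fstHom_comp_comp hθ, biprod.inl_snd, map_zero]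
  have hg : IsIso (d - c ≫ inv a ≫ b) := hY _ (by
    rw [map_sub, fstHom_comp_comp hθ, biprod.inr_snd, fstHom_comp, fstHom_comp, hb,
      LinearMap.zero_comp, LinearMap.zero_comp, sub_zero, fstHom_id])
  have key : (Biprod.unipotentLower (-c ≫ inv a)).hom ≫ θ ≫
      (Biprod.unipotentUpper (-inv a ≫ b)).hom = biprod.map a (d - c ≫ inv a ≫ b) := by
    rw [← Biprod.ofComponents_eq θ]
    exact (Biprod.gaussian' a b c d).2.2.2
  have : IsIso ((Biprod.unipotentLower (-c ≫ inv a)).hom ≫ θ ≫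
      (Biprod.unipotentUpper (-inv a ≫ b)).hom) := by
    rw [key]
    exact (biprod.mapIso (asIso a) (asIso (d - c ≫ inv a ≫ b))).isIso_hom
  have := IsIso.of_isIso_comp_left (Biprod.unipotentLower (-c ≫ inv a)).hom
    (θ ≫ (Biprod.unipotentUpper (-inv a ≫ b)).hom)
  exact IsIso.of_isIso_comp_right θ (Biprod.unipotentUpper (-inv a ≫ b)).hom

theorem fstHom_biprod_ext {θ : X ⊞ Y ⟶ Z} {θ' : X ⊞ Y ⟶ Z}
    (h₁ : fstHom _ _ (biprod.inl ≫ θ) = fstHom _ _ (biprod.inl ≫ θ'))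
    (h₂ : fstHom _ _ (biprod.inr ≫ θ) = fstHom _ _ (biprod.inr ≫ θ')) :
    fstHom _ _ θ = fstHom _ _ θ' := by
  have h : ∀ θ : X ⊞ Y ⟶ Z, θ = biprod.fst ≫ biprod.inl ≫ θ + biprod.snd ≫ biprod.inr ≫ θ := by
    intro θ
    rw [← Category.assoc, ← Category.assoc, ← Preadditive.add_comp, biprod.total,
      Category.id_comp]
  rw [h θ, h θ', map_add, map_add, fstHom_comp, fstHom_comp biprod.snd, h₁, h₂]
  rfl

/-- Objects whose submodules are complementary summands of a given one are complementary
summands. -/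
theorem nonempty_iso_biprod (hZ : Z.IsMinimal) (hX : X.IsMinimal) (hY : Y.IsMinimal)
    (i : X ⟶ Z) (r : Z ⟶ X) (j : Y ⟶ Z) (s : Z ⟶ Y) (hir : fstHom _ _ (i ≫ r) = LinearMap.id)
    (hjs : fstHom _ _ (j ≫ s) = LinearMap.id) (his : fstHom _ _ (i ≫ s) = 0)
    (hjr : fstHom _ _ (j ≫ r) = 0) (h : fstHom _ _ (r ≫ i + s ≫ j) = LinearMap.id) :
    Nonempty (Z ≅ X ⊞ Y) := by
  -- Both composites are identities only on the submodules; minimality upgrades them to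
  -- isomorphisms.
  have h1 : IsIso (biprod.lift r s ≫ biprod.desc i j) := hZ _ (by rw [biprod.lift_desc, h])
  have hl : ∀ {W : SubRep.{u} R} (k : W ⟶ Z), k ≫ biprod.lift r s =
      (k ≫ r) ≫ biprod.inl + (k ≫ s) ≫ biprod.inr := fun k => by
    rw [biprod.lift_eq, Preadditive.comp_add, Category.assoc, Category.assoc]
  have h2 : IsIso (biprod.desc i j ≫ biprod.lift r s) := (hX.biprod hY) _ (by
    rw [← fstHom_id]
    refine fstHom_biprod_ext ?_ ?_
    · rw [biprod.inl_desc_assoc, hl, map_add, fstHom_comp, fstHom_comp (i ≫ s), hir, his,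
        Category.comp_id, LinearMap.comp_id, LinearMap.comp_zero, add_zero]
    · rw [biprod.inr_desc_assoc, hl, map_add, fstHom_comp, fstHom_comp (j ≫ s), hjs, hjr,
        Category.comp_id, LinearMap.comp_id, LinearMap.comp_zero, zero_add])
  have := isIso_of_isIso_comp_comp (biprod.lift r s) (biprod.desc i j)
  exact ⟨asIso (biprod.lift r s)⟩

end SubRep

namespace ValTree

variable {n : ℕ}

/-! ### Retracts of trees -/

section Retract

variable (T : ValTree.{u} n)

/-- The subtree of fixed points of an endomorphism. -/
def fixedTree (r : T ⟶ T) : ValTree.{u} n where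
  carrier := {x // r.toFun x = x}
  root := ⟨T.root, hom_root r⟩
  par x := ⟨T.par x.1, by rw [r.map_par, x.2]⟩
  par_root := Subtype.ext T.par_root
  exists_iterate x := by
    obtain ⟨k, hk⟩ := T.exists_iterate x.1
    refine ⟨k, Subtype.ext (Eq.trans ?_ hk)⟩
    clear hk
    induction k generalizing x with
    | zero => rfl
    | succ k ih => exact ih _
  v x := T.v x.1
  v_lt_v_par x := T.v_lt_v_par x.1
  v_lt x hx := T.v_lt x.1 fun h => hx (Subtype.ext h)

open Classical in
/-- The image of an element in the quotient by the subtree of fixed points. -/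
def quotFun (r : T ⟶ T) (x : T.carrier) : {x // r.toFun x = x → x = T.root} :=
  if h : r.toFun x = x then ⟨T.root, fun _ => rfl⟩ else ⟨x, fun h' => absurd h' h⟩

theorem quotFun_of_eq {r : T ⟶ T} {x : T.carrier} (h : r.toFun x = x) :
    T.quotFun r x = ⟨T.root, fun _ => rfl⟩ := dif_pos h

theorem quotFun_of_ne {r : T ⟶ T} {x : T.carrier} (h : r.toFun x ≠ x) :
    T.quotFun r x = ⟨x, fun h' => absurd h' h⟩ := dif_neg h

theorem quotFun_val {r : T ⟶ T} (x : {x // r.toFun x = x → x = T.root}) :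
    T.quotFun r x.1 = x := by
  by_cases h : r.toFun x.1 = x.1
  · rw [quotFun_of_eq _ h]
    exact Subtype.ext (x.2 h).symm
  · rw [quotFun_of_ne _ h]

theorem v_le_quotFun (r : T ⟶ T) (x : T.carrier) : T.v x ≤ T.v (T.quotFun r x).1 := by
  by_cases h : r.toFun x = x
  · rw [quotFun_of_eq _ h, T.v_root]
    exact le_top
  · rw [quotFun_of_ne _ h]

theorem quotFun_par_val (r : T ⟶ T) (x : T.carrier) :
    T.quotFun r (T.par (T.quotFun r x).1) = T.quotFun r (T.par x) := by
  by_cases h : r.toFun x = x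
  · rw [quotFun_of_eq _ h, T.quotFun_of_eq (x := T.par x) (by rw [r.map_par, h]), quotFun_of_eq]
    change r.toFun (T.par T.root) = T.par T.root
    rw [T.par_root, hom_root]
  · rw [quotFun_of_ne _ h]

/-- The quotient of a tree by the subtree of fixed points of an endomorphism. -/
def quotTree (r : T ⟶ T) : ValTree.{u} n where
  carrier := {x // r.toFun x = x → x = T.root}
  root := ⟨T.root, fun _ => rfl⟩
  par x := T.quotFun r (T.par x.1)
  par_root := T.quotFun_of_eq (by rw [T.par_root, hom_root])
  exists_iterate x := by
    obtain ⟨k, hk⟩ := T.exists_iterate x.1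
    have key : ∀ k x, (fun x : {x // r.toFun x = x → x = T.root} =>
        T.quotFun r (T.par x.1))^[k] (T.quotFun r x) = T.quotFun r (T.par^[k] x) := by
      intro k
      induction k with
      | zero => exact fun _ => rfl
      | succ k ih =>
        intro x
        rw [Function.iterate_succ_apply, Function.iterate_succ_apply, ← ih]
        exact congrArg _ (T.quotFun_par_val r x)
    refine ⟨k, ?_⟩
    rw [← T.quotFun_val x, key, hk, T.quotFun_of_eq (hom_root r)]
  v x := T.v x.1
  v_lt_v_par x := by
    rcases T.v_lt_v_par x.1 with h | h
    · exact Or.inl (h.trans_le (T.v_le_quotFun r _))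
    · exact Or.inr ⟨h.1, top_le_iff.1 (h.2 ▸ T.v_le_quotFun r _)⟩
  v_lt x hx := T.v_lt x.1 fun h => hx (Subtype.ext h)

variable {T} {r : T ⟶ T}

theorem apply_apply_of_idem (hr : r ≫ r = r) (x : T.carrier) :
    r.toFun (r.toFun x) = r.toFun x :=
  congrFun (congrArg Hom.toFun hr) x

variable (r) in
/-- The inclusion of the subtree of fixed points. -/
def fixedIncl : T.fixedTree r ⟶ T where
  toFun := Subtype.val
  map_par _ := rfl
  le_v _ := le_rfl

/-- The retraction onto the subtree of fixed points. -/
def fixedProj (hr : r ≫ r = r) : T ⟶ T.fixedTree r where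
  toFun x := Subtype.mk (r.toFun x) (apply_apply_of_idem hr x)
  map_par x := Subtype.ext (r.map_par x)
  le_v x := r.le_v x

variable (r) in
/-- The projection to the quotient tree. -/
def quotProj : T ⟶ T.quotTree r where
  toFun := T.quotFun r
  map_par x := (T.quotFun_par_val r x).symm
  le_v := T.v_le_quotFun r

theorem card_fixedTree_lt {x : T.carrier} (hx : r.toFun x ≠ x) :
    Nat.card (T.fixedTree r).carrier < Nat.card T.carrier :=
  Finite.card_subtype_lt hx

theorem card_quotTree_lt (hr : r ≫ r = r) {x : T.carrier} (hx : r.toFun x ≠ T.root) :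
    Nat.card (T.quotTree r).carrier < Nat.card T.carrier :=
  Finite.card_subtype_lt (x := r.toFun x) fun h => hx (h (apply_apply_of_idem hr x))

theorem nontrivial_fixedTree (hr : r ≫ r = r) {x : T.carrier} (hx : r.toFun x ≠ T.root) :
    Nontrivial (T.fixedTree r).carrier :=
  ⟨⟨(fixedProj hr).toFun x, (T.fixedTree r).root, fun h => hx (congrArg Subtype.val h)⟩⟩

theorem nontrivial_quotTree {x : T.carrier} (hx : r.toFun x ≠ x) :
    Nontrivial (T.quotTree r).carrier :=
  ⟨⟨(Subtype.mk x fun h => absurd h hx), (T.quotTree r).root, fun h =>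
    hx (by rw [show x = T.root from congrArg Subtype.val h, hom_root])⟩⟩

theorem exists_of_not_irretractable (h : ¬ T.Irretractable) :
    ∃ r : T ⟶ T, r ≫ r = r ∧ (∃ x, r.toFun x ≠ x) ∧ ∃ x, r.toFun x ≠ T.root := by
  rw [Irretractable] at h
  push Not at h
  obtain ⟨r, h1, h2, h3⟩ := h
  refine ⟨r, h1, ?_, h3⟩
  by_contra! h
  exact h2 (hom_ext h)

/-- The difference `[x] - [r x]` vanishes on fixed points, so it depends only on the image of `x` in
the quotient tree; this makes `quotLift` well defined. -/
theorem cls_sub_quotFun (p : ℕ) (r : T ⟶ T) (x : T.carrier) :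
    T.cls p (T.quotFun r x).1 - T.cls p (r.toFun (T.quotFun r x).1) =
      T.cls p x - T.cls p (r.toFun x) := by
  by_cases h : r.toFun x = x
  · rw [quotFun_of_eq _ h, h, sub_self]
    exact sub_eq_zero.2 (congrArg _ (hom_root r).symm)
  · rw [quotFun_of_ne _ h]

/-- The homomorphism `[x] ↦ [x] - [r x]` from the group of the quotient tree. -/
def quotLift (p : ℕ) (r : T ⟶ T) : (T.quotTree r).S p →+ T.S p :=
  (T.quotTree r).lift p (fun x => T.cls p (Subtype.val x) - T.cls p (r.toFun (Subtype.val x)))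
    (by
      change T.cls p T.root - T.cls p (r.toFun T.root) = 0
      rw [hom_root, sub_self])
    (fun x => by
      rw [smul_sub, nsmul_cls, nsmul_cls, ← r.map_par]
      exact (cls_sub_quotFun p r _).symm)

theorem quotLift_quotProj (p : ℕ) (x : T.carrier) :
    quotLift p r ((T.quotTree r).cls p ((quotProj r).toFun x)) =
      T.cls p x - T.cls p (r.toFun x) := by
  rw [quotLift, lift_cls]
  exact cls_sub_quotFun p r x

end Retract

/-! ### The representation `M_T` -/

section Rep

variable {p : ℕ} {T T' T'' : ValTree.{u} n}

theorem valuated_mapS (f : T ⟶ T') : Valuated (mapS p f).toAddMonoidHom :=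
  Valuated.of_cls fun k x hx => by
    change mapS p f (T.cls p x) ∈ _
    rw [mapS_cls]
    exact cls_mem_filt (hx.trans (f.le_v x))

theorem valuated_quotLift (r : T ⟶ T) : Valuated (quotLift p r) :=
  Valuated.of_cls fun k x hx => by
    rw [quotLift, lift_cls]
    replace hx : (k : ℕ∞) ≤ T.v (Subtype.val x) := hx
    exact sub_mem (cls_mem_filt hx) (cls_mem_filt (hx.trans (r.le_v _)))

variable [Fact p.Prime]

instance : Finite (T.S p) :=
  have : NeZero (p ^ n) := ⟨pow_ne_zero _ (Fact.out (p := p.Prime)).ne_zero⟩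
  Module.finite_of_finite (ZMod (p ^ n))

/-- The homomorphism `S(T) → S(T')` given by a morphism `M_T ⟶ M_T'`. -/
def onS (φ : T.M p ⟶ T'.M p) : T.S p →+ T'.S p :=
  LinearMap.toAddMonoidHom (SubRep.fstHom (T.M p) (T'.M p) φ)

/-- The homomorphism `S(Tₙ₋₁) → S(T'ₙ₋₁)` given by a morphism `M_T ⟶ M_T'`. -/
def onStage (φ : T.M p ⟶ T'.M p) : (T.stage (n - 1)).S p →+ (T'.stage (n - 1)).S p :=
  LinearMap.toAddMonoidHom (SubRep.Hom.φ₂ φ)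

theorem onStage_toStage (φ : T.M p ⟶ T'.M p) (a : T.S p) :
    onStage φ (T.toStage p a) = T'.toStage p (onS φ a) :=
  LinearMap.congr_fun (SubRep.Hom.comm φ) a

theorem onS_comp (φ : T.M p ⟶ T'.M p) (ψ : T'.M p ⟶ T''.M p) :
    onS (φ ≫ ψ) = (onS ψ).comp (onS φ) := rfl

theorem onS_id : onS (𝟙 (T.M p)) = AddMonoidHom.id (T.S p) := rfl

theorem fstHom_eq_of_onS {φ ψ : T.M p ⟶ T'.M p} (h : onS φ = onS ψ) :
    SubRep.fstHom _ _ φ = SubRep.fstHom _ _ ψ :=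
  LinearMap.ext fun a => DFunLike.congr_fun h a

theorem onS_comp_apply_of_iso (e : T.M p ≅ T'.M p) (a : T.S p) : onS e.inv (onS e.hom a) = a := by
  have h := onS_comp e.hom e.inv
  rw [e.hom_inv_id, onS_id] at h
  exact (DFunLike.congr_fun h a).symm

/-- Divisibility by `p ^ k` upstairs is preserved by the second component. -/
theorem valuated_onS (hn : 0 < n) (φ : T.M p ⟶ T'.M p) : Valuated (onS φ) := by
  intro k a ha
  rw [mem_filt_iff hn] at ha ⊢
  obtain ⟨c, hc⟩ := ha
  exact ⟨onStage φ c, by rw [← onStage_toStage, hc, map_nsmul]⟩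

theorem Valuated.exists_onS_eq (hn : 0 < n) {f : T.S p →+ T'.S p} (hf : Valuated f) :
    ∃ φ : T.M p ⟶ T'.M p, onS φ = f := by
  obtain ⟨F, hF⟩ := hf.exists_extension hn
  let f₁ : T.S p →ₗ[ZMod (p ^ n)] T'.S p := f.toZModLinearMap (p ^ n)
  let F₁ : (T.stage (n - 1)).S p →ₗ[ZMod (p ^ n)] (T'.stage (n - 1)).S p :=
    F.toZModLinearMap (p ^ n)
  exact ⟨SubRep.Hom.mk (M := T.M p) (N := T'.M p) f₁ F₁
    (LinearMap.ext fun a => DFunLike.congr_fun hF a), rfl⟩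

theorem M_isMinimal (hn : 0 < n) : (T.M p).IsMinimal := by
  intro θ hθ
  have h1 : ∀ a, onS θ a = a := fun a => LinearMap.congr_fun hθ a
  have h2 : Function.Injective (onStage θ) :=
    injective_of_comp_toStage hn fun a => by rw [onStage_toStage, h1]
  have h3 : Function.Surjective (onStage θ) := Finite.surjective_of_injective h2
  refine SubRep.isIso_of_bijective θ ?_ ⟨h2, h3⟩
  have : Function.Bijective (onS θ) := by
    rw [show onS θ = AddMonoidHom.id _ from AddMonoidHom.ext h1]
    exact Function.bijective_id
  exact this

/-- By finiteness, `f` maps each step of the filtration onto itself, so its inverse is valuated as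
well. -/
theorem Valuated.exists_inverse {f : T.S p →+ T.S p} (hf : Valuated f)
    (hinj : Function.Injective f) :
    ∃ g : T.S p →+ T.S p, Valuated g ∧ g.comp f = AddMonoidHom.id _ ∧
      f.comp g = AddMonoidHom.id _ := by
  let e := AddEquiv.ofBijective f ⟨hinj, Finite.surjective_of_injective hinj⟩
  refine ⟨e.symm.toAddMonoidHom, fun k a ha => ?_, AddMonoidHom.ext e.symm_apply_apply,
    AddMonoidHom.ext e.apply_symm_apply⟩
  let f' : T.filt p k → T.filt p k := fun a => ⟨f a.1, hf k a.1 a.2⟩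
  have hf' : Function.Injective f' := fun a b h =>
    Subtype.ext (hinj (congrArg Subtype.val h))
  obtain ⟨b, hb⟩ := Finite.surjective_of_injective hf' ⟨a, ha⟩
  have : e.symm a = b.1 := by
    rw [AddEquiv.symm_apply_eq]
    exact (congrArg Subtype.val hb).symm
  change e.symm a ∈ _
  rw [this]
  exact b.2

theorem isIso_of_injective_onS (hn : 0 < n) (φ : T.M p ⟶ T.M p)
    (h : Function.Injective (onS φ)) : IsIso φ := by
  obtain ⟨g, hg, h1, h2⟩ := (valuated_onS hn φ).exists_inverse h
  obtain ⟨ψ, rfl⟩ := hg.exists_onS_eq hn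
  have := M_isMinimal hn _ ((fstHom_eq_of_onS (φ := φ ≫ ψ) (ψ := 𝟙 _) h1).trans SubRep.fstHom_id)
  have := M_isMinimal hn _ ((fstHom_eq_of_onS (φ := ψ ≫ φ) (ψ := 𝟙 _) h2).trans SubRep.fstHom_id)
  exact isIso_of_isIso_comp_comp φ ψ

/-! ### Indecomposability and decomposition of `M_T` -/

theorem isZero_M (hn : 0 < n) (h : ¬ Nontrivial T.carrier) : IsZero (T.M p) := by
  rw [not_nontrivial_iff_subsingleton] at h
  have h0 : ∀ f : T.S p →+ T.S p, f = 0 := fun f => addHom_ext fun x => by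
    rw [Subsingleton.elim x T.root, cls_root, map_zero, map_zero]
  -- As `S(T) = 0`, the zero endomorphism is the identity on `S(T)`, hence an isomorphism.
  have := M_isMinimal (T := T) (p := p) hn 0
    (fstHom_eq_of_onS (ψ := 𝟙 _) ((h0 _).trans (h0 _).symm))
  rw [IsZero.iff_id_eq_zero, ← IsIso.hom_inv_id (0 : T.M p ⟶ T.M p), zero_comp]

theorem not_isZero_M (h : Nontrivial T.carrier) : ¬ IsZero (T.M p) := by
  intro h0
  rw [IsZero.iff_id_eq_zero] at h0
  obtain ⟨x, hx⟩ := exists_ne T.root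
  have : onS (𝟙 (T.M p)) = 0 := by rw [h0]; rfl
  exact cls_ne_zero (p := p) hx (DFunLike.congr_fun this (T.cls p x))

theorem nonempty_iso_of_subsingleton (h : ¬ Nontrivial T.carrier) (h' : ¬ Nontrivial T'.carrier) :
    Nonempty (T ≅ T') := by
  rw [not_nontrivial_iff_subsingleton] at h h'
  have zeroHom : ∀ U V : ValTree.{u} n, Nonempty (U ⟶ V) := fun U V =>
    ⟨⟨fun _ => V.root, fun _ => V.par_root.symm, fun _ => by rw [V.v_root]; exact le_top⟩⟩
  obtain ⟨f⟩ := zeroHom T T'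
  obtain ⟨g⟩ := zeroHom T' T
  exact ⟨⟨f, g, hom_ext fun _ => Subsingleton.elim _ _, hom_ext fun _ => Subsingleton.elim _ _⟩⟩

/-- The functional is the coefficient at the top of the image of the class of the top. -/
theorem hasLocalFunctional_M (hn : 0 < n) [Nontrivial T.carrier] (hT : T.Irretractable) :
    HasLocalFunctional (T.M p) := by
  obtain ⟨x, hx, hpx⟩ := T.exists_par_eq_root
  refine ⟨ZMod (p ^ n), inferInstance,
    { toFun := fun φ => T.coeff p x (onS φ (T.cls p x))
      map_zero' := map_zero (T.coeff p x)
      map_add' := fun φ ψ => map_add (T.coeff p x) _ _ }, ?_, fun φ h => ?_⟩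
  · change T.coeff p x (T.cls p x) ≠ 0
    rw [coeff_self hx]
    exact pow_ne_zero_zmod hn
  · exact isIso_of_injective_onS hn φ ((valuated_onS hn φ).injective_of_coeff_top hn hT hx hpx h)

/-- `S(r)` is an idempotent of `S(T)`. Its image is the group of the fixed tree, and its kernel is
that of the quotient tree, embedded by `[x] ↦ [x] - [r x]`. All four maps are valuated, so they lift
to the representations. -/
theorem nonempty_iso_biprod_of_idem (hn : 0 < n) {r : T ⟶ T} (hr : r ≫ r = r) :
    Nonempty (T.M p ≅ (T.fixedTree r).M p ⊞ (T.quotTree r).M p) := by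
  obtain ⟨I, hI⟩ := (valuated_mapS (p := p) (fixedIncl r)).exists_onS_eq hn
  obtain ⟨P, hP⟩ := (valuated_mapS (p := p) (fixedProj hr)).exists_onS_eq hn
  obtain ⟨J, hJ⟩ := (valuated_quotLift (p := p) r).exists_onS_eq hn
  obtain ⟨Q, hQ⟩ := (valuated_mapS (p := p) (quotProj r)).exists_onS_eq hn
  have hI' : ∀ x, onS I ((T.fixedTree r).cls p x) = T.cls p ((fixedIncl r).toFun x) :=
    fun x => by rw [hI]; exact mapS_cls p _ x
  have hP' : ∀ x, onS P (T.cls p x) = (T.fixedTree r).cls p ((fixedProj hr).toFun x) :=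
    fun x => by rw [hP]; exact mapS_cls p _ x
  have hQ' : ∀ x, onS Q (T.cls p x) = (T.quotTree r).cls p ((quotProj r).toFun x) :=
    fun x => by rw [hQ]; exact mapS_cls p _ x
  have hJ' : ∀ x : (T.quotTree r).carrier, onS J ((T.quotTree r).cls p x) =
      T.cls p (Subtype.val x) - T.cls p (r.toFun (Subtype.val x)) := fun x => by
    rw [hJ, quotLift, lift_cls]
  refine SubRep.nonempty_iso_biprod (M_isMinimal hn) (M_isMinimal hn) (M_isMinimal hn) I P J Q
    ((fstHom_eq_of_onS (ψ := 𝟙 _) ?_).trans SubRep.fstHom_id)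
    ((fstHom_eq_of_onS (ψ := 𝟙 _) ?_).trans SubRep.fstHom_id)
    ((fstHom_eq_of_onS (ψ := 0) ?_).trans (map_zero _))
    ((fstHom_eq_of_onS (ψ := 0) ?_).trans (map_zero _))
    ((fstHom_eq_of_onS (ψ := 𝟙 _) ?_).trans SubRep.fstHom_id)
  · refine addHom_ext fun x => ?_
    rw [onS_comp, AddMonoidHom.comp_apply, hI', hP']
    exact congrArg _ (Subtype.ext (Subtype.property x))
  · refine addHom_ext fun x => ?_
    rw [onS_comp, AddMonoidHom.comp_apply, hJ', map_sub, hQ', hQ']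
    have h1 : (quotProj r).toFun (Subtype.val x) = x := T.quotFun_val x
    have h2 : (quotProj r).toFun (r.toFun (Subtype.val x)) = (T.quotTree r).root :=
      T.quotFun_of_eq (apply_apply_of_idem hr _)
    rw [h1, h2, cls_root, sub_zero]
    rfl
  · refine addHom_ext fun x => ?_
    rw [onS_comp, AddMonoidHom.comp_apply, hI', hQ']
    have h2 : (quotProj r).toFun ((fixedIncl r).toFun x) = (T.quotTree r).root :=
      T.quotFun_of_eq (Subtype.property x)
    rw [h2, cls_root]
    rfl
  · refine addHom_ext fun x => ?_
    rw [onS_comp, AddMonoidHom.comp_apply, hJ', map_sub, hP', hP']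
    have h2 : (fixedProj hr).toFun (r.toFun (Subtype.val x)) =
        (fixedProj hr).toFun (Subtype.val x) := Subtype.ext (apply_apply_of_idem hr _)
    rw [h2, sub_self]
    rfl
  · refine addHom_ext fun x => ?_
    have h1 : onS (P ≫ I + Q ≫ J) (T.cls p x) =
        onS I (onS P (T.cls p x)) + onS J (onS Q (T.cls p x)) := rfl
    rw [h1, hP', hI', hQ', hJ, quotLift_quotProj]
    have h2 : (fixedIncl r).toFun ((fixedProj hr).toFun x) = r.toFun x := rfl
    rw [h2, add_sub_cancel]
    rfl

theorem indecomposable_M_iff (hn : 0 < n) :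
    Indecomposable (T.M p) ↔ Nontrivial T.carrier ∧ T.Irretractable := by
  constructor
  · rintro ⟨h0, h⟩
    refine ⟨by by_contra h'; exact h0 (isZero_M hn h'), ?_⟩
    by_contra hT
    obtain ⟨r, hr, ⟨x, hx⟩, ⟨y, hy⟩⟩ := exists_of_not_irretractable hT
    obtain ⟨e⟩ := nonempty_iso_biprod_of_idem (p := p) hn hr
    rcases h _ _ e with h | h
    · exact not_isZero_M (nontrivial_fixedTree hr hy) h
    · exact not_isZero_M (nontrivial_quotTree hx) h
  · rintro ⟨hnt, hT⟩
    refine ⟨not_isZero_M hnt, fun Y Z e => ?_⟩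
    by_contra! hYZ
    have : IsIso ((biprod.inl ≫ e.inv) ≫ e.hom ≫ biprod.fst) := by
      rw [Category.assoc, e.inv_hom_id_assoc, biprod.inl_fst]
      infer_instance
    have := (hasLocalFunctional_M hn hT).isIso_of_comp hYZ.1 (biprod.inl ≫ e.inv)
      (e.hom ≫ biprod.fst)
    have h0 : (biprod.inl ≫ e.inv) ≫ (e.hom ≫ biprod.snd : T.M p ⟶ Z) = 0 := by
      rw [Category.assoc, e.inv_hom_id_assoc, biprod.inl_snd]
    have h1 : (e.hom ≫ biprod.snd : T.M p ⟶ Z) = 0 := by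
      rw [← cancel_epi (biprod.inl ≫ e.inv : Y ⟶ T.M p), h0, comp_zero]
    apply hYZ.2
    rw [IsZero.iff_id_eq_zero, ← biprod.inr_snd, ← e.inv_hom_id_assoc biprod.snd, h1, comp_zero,
      comp_zero]

/-- Induction on the size of `T`, with `G` accumulating the summands already found: those of the
quotient tree are added to `G` before the fixed tree is treated. -/
theorem exists_decomposition (hn : 0 < n) (N : ℕ) (T : ValTree.{u} n)
    (hN : Nat.card T.carrier ≤ N) (k : ℕ) (G : Fin k → ValTree.{u} n)
    (hG : ∀ i, Nontrivial (G i).carrier ∧ (G i).Irretractable) :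
    ∃ (m : ℕ) (F : Fin m → ValTree.{u} n),
      (∀ i, Nontrivial (F i).carrier ∧ (F i).Irretractable) ∧
        Nonempty ((T.M p ⊞ ⨁ fun i => (G i).M p) ≅ ⨁ fun i => (F i).M p) := by
  induction N generalizing T k G with
  | zero =>
    have : 0 < Nat.card T.carrier := Nat.card_pos_iff.2 ⟨⟨T.root⟩, inferInstance⟩
    omega
  | succ N ih =>
    by_cases hnt : Nontrivial T.carrier
    · by_cases hT : T.Irretractable
      · refine ⟨k + 1, Fin.cons T G, fun i => ?_, ⟨?_⟩⟩
        · refine Fin.cases ⟨hnt, hT⟩ (fun j => ?_) i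
          simpa using hG j
        · exact biprod.mapIso (Iso.refl _) (biproduct.mapIso fun i => eqToIso (by simp)) ≪≫
            biproductSuccAboveIso (fun i => ((Fin.cons T G : Fin (k + 1) → ValTree.{u} n) i).M p) 0
      · obtain ⟨r, hr, ⟨x, hx⟩, ⟨y, hy⟩⟩ := exists_of_not_irretractable hT
        obtain ⟨e⟩ := nonempty_iso_biprod_of_idem (p := p) hn hr
        have h1 := card_fixedTree_lt hx
        have h2 := card_quotTree_lt hr hy
        obtain ⟨k', G', hG', ⟨e'⟩⟩ := ih (T.quotTree r) (by omega) k G hG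
        obtain ⟨m, F, hF, ⟨e''⟩⟩ := ih (T.fixedTree r) (by omega) k' G' hG'
        exact ⟨m, F, hF, ⟨biprod.mapIso e (Iso.refl _) ≪≫ biprod.associator _ _ _ ≪≫
          biprod.mapIso (Iso.refl _) e' ≪≫ e''⟩⟩
    · exact ⟨k, G, hG, ⟨(isoZeroBiprod (isZero_M hn hnt)).symm⟩⟩

end Rep

end ValTree

end

theorem corollary3p15 (p : ℕ) [Fact p.Prime] (n : ℕ) (hn : 0 < n) (T : ValTree.{u} n) :
    -- `M_T` is indecomposable iff `T` is irretractable and not the one-element tree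
    (Indecomposable (T.M p) ↔ Nontrivial T.carrier ∧ T.Irretractable) ∧
    -- for irretractable `T`, the tree is determined by `M_T`
    (T.Irretractable → ∀ T' : ValTree.{u} n, Nonempty (T.M p ≅ T'.M p) → Nonempty (T ≅ T')) ∧
    -- existence of the decomposition, and its uniqueness up to isomorphism and permutation
    (∃ (m : ℕ) (F : Fin m → ValTree.{u} n),
      ((∀ i, Nontrivial (F i).carrier ∧ (F i).Irretractable) ∧
        Nonempty (T.M p ≅ ⨁ fun i => (F i).M p)) ∧
      ∀ (m' : ℕ) (F' : Fin m' → ValTree.{u} n),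
        (∀ j, Nontrivial (F' j).carrier ∧ (F' j).Irretractable) →
        Nonempty (T.M p ≅ ⨁ fun j => (F' j).M p) →
        ∃ e : Fin m' ≃ Fin m, ∀ j, Nonempty (F' j ≅ F (e j))) := by
  have hiso : ∀ T : ValTree.{u} n, T.Irretractable → ∀ T' : ValTree.{u} n,
      Nonempty (T.M p ≅ T'.M p) → Nonempty (T ≅ T') := by
    rintro T hT T' ⟨e⟩
    by_cases hnt : Nontrivial T.carrier
    -- Irretractability of `T'` is not assumed; it follows from the indecomposability of `M_T' ≅
    -- M_T`.
    · have hT' : Nontrivial T'.carrier ∧ T'.Irretractable := by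
        rw [← ValTree.indecomposable_M_iff (p := p) hn]
        obtain ⟨h0, h⟩ := (ValTree.indecomposable_M_iff (p := p) hn).2 ⟨hnt, hT⟩
        exact ⟨fun h' => h0 (h'.of_iso e), fun Y Z f => h Y Z (e ≪≫ f)⟩
      exact ValTree.nonempty_iso_of_valuated hn hT hT'.2 (ValTree.valuated_onS hn e.hom)
        (ValTree.valuated_onS hn e.inv) (ValTree.onS_comp_apply_of_iso e)
    · refine ValTree.nonempty_iso_of_subsingleton hnt fun hnt' => ?_
      exact ValTree.not_isZero_M hnt' ((ValTree.isZero_M (p := p) hn hnt).of_iso e.symm)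
  refine ⟨ValTree.indecomposable_M_iff hn, hiso T, ?_⟩
  obtain ⟨m, F, hF, ⟨φ⟩⟩ := ValTree.exists_decomposition (p := p) hn _ T le_rfl 0 Fin.elim0
    fun i => i.elim0
  have h0 : IsZero (⨁ fun i : Fin 0 => ValTree.M p (Fin.elim0 i : ValTree.{u} n)) := by
    rw [IsZero.iff_id_eq_zero, ← biproduct.total]
    simp
  let φ' := isoBiprodZero h0 ≪≫ φ
  refine ⟨m, F, ⟨hF, ⟨φ'⟩⟩, ?_⟩
  rintro m' F' hF' ⟨ψ⟩
  obtain ⟨e, he⟩ := exists_equiv_of_iso (fun i => (F i).M p) (fun i => (F' i).M p)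
    (fun i => have := (hF i).1; ValTree.hasLocalFunctional_M hn (hF i).2)
    (fun i => have := (hF' i).1; ValTree.hasLocalFunctional_M hn (hF' i).2) (ψ.symm ≪≫ φ')
  exact ⟨e, fun j => hiso _ (hF' j).2 _ (he j)⟩
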